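/- Let $E_1$ be the operator on $L^2(\mathbb{R}^2;\mathbb{C})$ given by the Fourier multiplier $\xi_1^2/|\xi|^2$, that is, $E_1 f=\mathcal{F}^{-1}\big(\tfrac{\xi_1^2}{|\xi|^2}\,\mathcal{F}f\big)$. Let $1<p<3$ and $\omega\in\mathbb{R}$. If there is a function $u\in H^1(\mathbb{R}^2;\mathbb{C})$, $u\neq 0$, that satisfies $$\Delta u-\omega u+|u|^{p-1}u+E_1(|u|^2)u=0$$ on $\mathbb{R}^2$ in the sense of distributions, then $\omega>0$. (Here $|u|^2\in L^2(\mathbb{R}^2)$ because $H^1(\mathbb{R}^2)\subset L^4(\mathbb{R}^2)$.) -/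

import Mathlib

open MeasureTheory FourierTransform
open scoped SchwartzMap ENNReal

noncomputable section

namespace DaveyStewartson

/-- The Euclidean plane. -/
abbrev Plane : Type := EuclideanSpace ℝ (Fin 2)

/-- Complex-valued square-integrable functions on the plane (Lebesgue measure). -/
abbrev L2 : Type := Lp ℂ 2 (volume : Measure Plane)

/-- The symbol `ξ₁² / |ξ|²`. Its value at the single point `ξ = 0` is irrelevant. -/
def symbol (ξ : Plane) : ℝ := ξ 0 ^ 2 / ‖ξ‖ ^ 2

theorem measurable_symbol : Measurable symbol := by
  unfold symbol
  fun_prop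

theorem symbol_nonneg (ξ : Plane) : 0 ≤ symbol ξ := by
  unfold symbol
  positivity

theorem symbol_le_one (ξ : Plane) : symbol ξ ≤ 1 := by
  refine div_le_one_of_le₀ ?_ (by positivity)
  rw [EuclideanSpace.real_norm_sq_eq, Fin.sum_univ_two]
  nlinarith [sq_nonneg (ξ 1)]

theorem memLp_symbol_mul (g : L2) :
    MemLp (fun ξ : Plane => (symbol ξ : ℂ) * g ξ) 2 volume := by
  refine (Lp.memLp g).of_le ?_ (Filter.Eventually.of_forall fun ξ => ?_)
  · exact (Complex.measurable_ofReal.comp measurable_symbol).aestronglyMeasurable.mul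
      (Lp.aestronglyMeasurable g)
  · rw [norm_mul, Complex.norm_real, Real.norm_of_nonneg (symbol_nonneg ξ)]
    exact mul_le_of_le_one_left (norm_nonneg _) (symbol_le_one ξ)

/-- The singular integral operator `E₁ f = 𝓕⁻¹ (ξ₁² / |ξ|² · 𝓕 f)` on `L²`. Here `𝓕` is the
Plancherel transform extending `∫ e^{-2πi x·ξ} f(x) dx`; since the symbol is homogeneous of
degree zero, the normalization `(2π)⁻¹ ∫ e^{-i x·ξ} f(x) dx` gives the same operator. -/
def E₁L2 (f : L2) : L2 := 𝓕⁻ ((memLp_symbol_mul (𝓕 f)).toLp _)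

open Classical in
/-- `E₁` applied to a square-integrable function. The second branch is a placeholder that is
never used for `f = |u|²` with `u ∈ H¹`, because `H¹` of the plane embeds in `L⁴`. -/
def E₁ (f : Plane → ℂ) : Plane → ℂ :=
  if hf : MemLp f 2 volume then E₁L2 (hf.toLp f) else 0

/-- `u ∈ H¹` is a solution, in the sense of distributions, of
`Δu - ω u + |u|^{p-1} u + E₁(|u|²) u = 0` on the plane. -/
structure IsSolution (p ω : ℝ) (u : L2) : Prop where
  memH1 : TemperedDistribution.MemSobolev 1 2 (u : 𝓢'(Plane, ℂ))
  equation : ∀ φ : Plane → ℂ, ContDiff ℝ ((⊤ : ℕ∞) : WithTop ℕ∞) φ → HasCompactSupport φ →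
    (∫ x, u x * Laplacian.laplacian φ x) - ω * (∫ x, u x * φ x)
      + (∫ x, ((‖u x‖ ^ (p - 1) : ℝ) : ℂ) * u x * φ x)
      + (∫ x, E₁ (fun y => ((‖u y‖ ^ 2 : ℝ) : ℂ)) x * u x * φ x) = 0

end DaveyStewartson

end

noncomputable section

namespace DaveyStewartson

open Real ComplexConjugate Filter Topology
open scoped RealInnerProductSpace

/-! ### The Fourier transform on `L²` -/

/-! This is a Pohozaev argument. Formally, pairing the equation with x·∇ū and taking real parts
gives, in dimension two, ω ∫|u|² = 2/(p+1) ∫|u|^{p+1} + ½ ∫ m |𝓕(|u|²)|², where m is the symbol of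
`E₁` (`IsSolution.pohozaev`). The Dirichlet energy drops out because it is scale invariant in the
plane. Since m ≥ 0 and u ≠ 0, the right side is positive, hence so is ω.

For u merely in H¹ the function x·∇ū is not an admissible test function. No extra regularity or
decay of u is proved. Instead, for each coordinate j, the factor x_j is replaced by the bounded
weight sin(2πt x_j)/(2πt), and ∂_j by a central difference of step h. The resulting test function
lies in H¹, and the equation extends to such functions (`IsSolution.weak_form`): both |u|^{p-1}
(because p < 3) and E₁(|u|²) are potentials in L^∞ + L², and Ladyzhenskaya's inequality puts H¹ into
L⁴.

First h → 0. Quadratic terms are handled by moving the difference onto the weight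
(`IsWeight.tendsto_quadratic`), and the term where the derivative falls on the weight by Plancherel
(`tendsto_integral_centralDifference`). The nonlinear terms become exact differences up to
remainders quadratic in u(x + h e_j) - u(x), which are o(h) by Ladyzhenskaya (`tendsto_remainder`).

The nonlocal term is the reason for the sine: multiplication by it is a difference of two
translations in frequency, so Plancherel yields an explicit integral against ξ_j m(ξ - t e_j) - (ξ_j
- t) m(ξ). This commutator is at most 2|t|, because m is homogeneous of degree zero and its
increments satisfy `abs_symbol_sub_mul_norm_le`. As t → 0 the normalized kernel tends to ½(ξ_j ∂_j m
- m). Summing over j, Euler's relation ξ·∇m = 0 leaves -m. -/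

theorem toTemperedDistribution_injective {f g : L2}
    (h : ∀ φ : 𝓢(Plane, ℂ), ∫ x, φ x * f x = ∫ x, φ x * g x) : f = g := by
  have hker := Lp.ker_toTemperedDistributionCLM_eq_bot (F := ℂ) (μ := (volume : Measure Plane))
    (p := 2)
  refine LinearMap.ker_eq_bot.1 hker ?_
  change (f : 𝓢'(Plane, ℂ)) = (g : 𝓢'(Plane, ℂ))
  ext φ
  simpa using h φ

/-- The Plancherel transform has no pointwise integral formula, so identities for it are obtained by
moving 𝓕 onto a Schwartz function, computing there, and concluding with
`toTemperedDistribution_injective`. -/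
theorem integral_mul_fourier (f : L2) (φ : 𝓢(Plane, ℂ)) :
    ∫ x, φ x * (𝓕 f : L2) x = ∫ x, (𝓕 φ) x * f x := by
  have h := DFunLike.congr_fun (Lp.fourier_toTemperedDistribution_eq f) φ
  rw [TemperedDistribution.fourier_apply] at h
  simpa using h.symm

theorem integral_mul_fourierInv (f : L2) (φ : 𝓢(Plane, ℂ)) :
    ∫ x, φ x * (𝓕⁻ f : L2) x = ∫ x, (𝓕⁻ φ) x * f x := by
  have h := DFunLike.congr_fun (Lp.fourierInv_toTemperedDistribution_eq f) φ
  rw [TemperedDistribution.fourierInv_apply] at h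
  simpa using h.symm

theorem measurePreserving_add_const (h : Plane) :
    MeasurePreserving (fun x : Plane => x + h) volume volume :=
  measurePreserving_add_right volume h

/-- The translate `x ↦ f (x + h)` of an `L²` function. -/
def translate (h : Plane) (f : L2) : L2 :=
  Lp.compMeasurePreserving (fun x : Plane => x + h) (measurePreserving_add_const h) f

theorem coeFn_translate (h : Plane) (f : L2) :
    translate h f =ᵐ[volume] fun x => f (x + h) :=
  Lp.coeFn_compMeasurePreserving f (measurePreserving_add_const h)

/-- The plane wave `e^{2πi τ·x}`. -/
def wave (τ x : Plane) : ℂ := Complex.exp ((2 * π * ⟪τ, x⟫ : ℝ) * Complex.I)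

theorem continuous_wave (τ : Plane) : Continuous (wave τ) := by
  unfold wave
  fun_prop

@[simp]
theorem norm_wave (τ x : Plane) : ‖wave τ x‖ = 1 := Complex.norm_exp_ofReal_mul_I _

theorem wave_eq_fourierChar (τ x : Plane) : wave τ x = ((𝐞 ⟪τ, x⟫ : Circle) : ℂ) :=
  (Real.fourierChar_apply _).symm

theorem wave_neg_left (τ x : Plane) : wave (-τ) x = wave τ (-x) := by simp [wave]

theorem fourier_compSubConst (φ : 𝓢(Plane, ℂ)) (τ x : Plane) :
    (𝓕 (φ.compSubConstCLM ℂ τ)) x = wave (-τ) x * (𝓕 φ) x := by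
  have h := congr_fun (VectorFourier.fourierIntegral_comp_add_right 𝐞 (volume : Measure Plane)
    (innerₗ Plane) φ (-τ)) x
  have e : (φ.compSubConstCLM ℂ τ : Plane → ℂ) = φ ∘ fun v => v + -τ := by
    ext y; simp [sub_eq_add_neg]
  rw [SchwartzMap.fourier_coe, SchwartzMap.fourier_coe, e]
  change VectorFourier.fourierIntegral 𝐞 volume (innerₗ Plane) _ x = _
  rw [h]
  rw [wave_eq_fourierChar, Circle.smul_def]
  rfl

theorem fourierInv_compSubConst (φ : 𝓢(Plane, ℂ)) (τ x : Plane) :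
    (𝓕⁻ (φ.compSubConstCLM ℂ τ)) x = wave τ x * (𝓕⁻ φ) x := by
  have h := fourier_compSubConst φ τ (-x)
  rw [SchwartzMap.fourier_coe, SchwartzMap.fourier_coe] at h
  rw [SchwartzMap.fourierInv_coe, SchwartzMap.fourierInv_coe, Real.fourierInv_eq_fourier_neg,
    Real.fourierInv_eq_fourier_neg, h, wave_neg_left, neg_neg]

/-- Modulation becomes translation under the Fourier transform. -/
theorem fourier_modulation {f F : L2} {τ : Plane}
    (hF : F =ᵐ[volume] fun x => wave τ x * f x) : 𝓕 F = translate (-τ) (𝓕 f) := by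
  refine toTemperedDistribution_injective fun φ => ?_
  rw [integral_mul_fourier]
  calc ∫ x, (𝓕 φ) x * F x = ∫ x, (𝓕 (φ.compSubConstCLM ℂ (-τ))) x * f x := by
        refine integral_congr_ae ?_
        filter_upwards [hF] with x hx
        rw [hx, fourier_compSubConst]
        rw [neg_neg]
        ring
    _ = ∫ x, φ (x + τ) * (𝓕 f : L2) x := by
        rw [← integral_mul_fourier]
        simp
    _ = ∫ x, φ x * (𝓕 f : L2) (x + -τ) := by
        rw [← integral_add_right_eq_self _ (-τ)]
        simp
    _ = _ := by
        refine integral_congr_ae ?_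
        filter_upwards [coeFn_translate (-τ) (𝓕 f : L2)] with x hx
        rw [hx]

/-- Modulation becomes translation under the inverse Fourier transform. -/
theorem fourierInv_modulation {f F : L2} {τ : Plane}
    (hF : F =ᵐ[volume] fun x => wave τ x * f x) : 𝓕⁻ F = translate τ (𝓕⁻ f) := by
  refine toTemperedDistribution_injective fun φ => ?_
  rw [integral_mul_fourierInv]
  calc ∫ x, (𝓕⁻ φ) x * F x = ∫ x, (𝓕⁻ (φ.compSubConstCLM ℂ τ)) x * f x := by
        refine integral_congr_ae ?_
        filter_upwards [hF] with x hx
        rw [hx, fourierInv_compSubConst]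
        ring
    _ = ∫ x, φ (x - τ) * (𝓕⁻ f : L2) x := by
        rw [← integral_mul_fourierInv]
        simp
    _ = ∫ x, φ x * (𝓕⁻ f : L2) (x + τ) := by
        rw [← integral_add_right_eq_self _ τ]
        simp
    _ = _ := by
        refine integral_congr_ae ?_
        filter_upwards [coeFn_translate τ (𝓕⁻ f : L2)] with x hx
        rw [hx]

theorem memLp_modulation (τ : Plane) (f : L2) :
    MemLp (fun x : Plane => wave τ x * f x) 2 volume := by
  refine (Lp.memLp f).of_le ?_ (Filter.Eventually.of_forall fun x => by simp)
  refine AEStronglyMeasurable.mul ?_ (Lp.aestronglyMeasurable f)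
  exact (continuous_wave τ).aestronglyMeasurable

/-- Translation becomes modulation under the Fourier transform. -/
theorem fourier_translate (τ : Plane) (f : L2) :
    (𝓕 (translate τ f) : L2) =ᵐ[volume] fun ξ => wave τ ξ * (𝓕 f : L2) ξ := by
  set F : L2 := (memLp_modulation τ (𝓕 f)).toLp _
  have hF := (memLp_modulation τ (𝓕 f)).coeFn_toLp
  have h : 𝓕⁻ F = translate τ f := by
    rw [fourierInv_modulation hF, fourierInv_fourier_eq]
  rw [← h, fourier_fourierInv_eq]
  exact hF

/-- The Fourier transform of a conjugate. -/
theorem fourier_conj {f F : L2} (hF : F =ᵐ[volume] fun x => conj (f x)) :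
    (𝓕 F : L2) =ᵐ[volume] fun ξ => conj ((𝓕 f : L2) (-ξ)) := by
  have hneg : MeasurePreserving (fun x : Plane => -x) volume volume :=
    Measure.measurePreserving_neg volume
  have hm : MemLp (fun ξ => conj ((𝓕 f : L2) (-ξ))) 2 volume :=
    ((Lp.memLp (𝓕 f : L2)).comp_measurePreserving hneg).star
  have key : 𝓕 F = hm.toLp _ := by
    refine toTemperedDistribution_injective fun φ => ?_
    rw [integral_mul_fourier]
    -- The function ψ(x) = conj φ(-x) is chosen so that 𝓕ψ = conj 𝓕φ; the conjugation can then be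
    -- pulled out of the whole pairing.
    set ψ : 𝓢(Plane, ℂ) :=
      (SchwartzMap.compCLMOfContinuousLinearEquiv ℝ (ContinuousLinearEquiv.neg ℝ) φ).postcompCLM
        (Complex.conjCLE : ℂ →L[ℝ] ℂ) with hψ
    have hψ1 : ∀ x, ψ x = conj (φ (-x)) := fun x => by simp [hψ]
    have hψ2 : ∀ x, (𝓕 ψ) x = conj ((𝓕 φ) x) := fun x => by
      rw [SchwartzMap.fourier_coe, SchwartzMap.fourier_coe, Real.fourier_eq, Real.fourier_eq,
        ← integral_conj, ← integral_neg_eq_self]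
      refine integral_congr_ae (Filter.Eventually.of_forall fun y => ?_)
      simp [hψ1, Circle.smul_def, ← Circle.coe_inv_eq_conj, AddChar.map_neg_eq_inv]
    calc ∫ x, (𝓕 φ) x * F x = ∫ x, conj ((𝓕 ψ) x * f x) := by
          refine integral_congr_ae ?_
          filter_upwards [hF] with x hx
          rw [hx, hψ2]; simp
      _ = conj (∫ x, ψ x * (𝓕 f : L2) x) := by
          rw [integral_conj, integral_mul_fourier]
      _ = ∫ x, φ x * conj ((𝓕 f : L2) (-x)) := by
          rw [← integral_conj, ← integral_neg_eq_self]
          refine integral_congr_ae (Filter.Eventually.of_forall fun y => ?_)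
          simp [hψ1]
      _ = _ := by
          refine integral_congr_ae ?_
          filter_upwards [hm.coeFn_toLp] with x hx
          rw [hx]
  rw [key]
  exact hm.coeFn_toLp

/-! ### The operator `E₁` on the Fourier side -/

theorem symbol_neg (ξ : Plane) : symbol (-ξ) = symbol ξ := by simp [symbol]

theorem fourier_E₁L2 (f : L2) :
    (𝓕 (E₁L2 f) : L2) =ᵐ[volume] fun ξ => (symbol ξ : ℂ) * (𝓕 f : L2) ξ := by
  rw [E₁L2, fourier_fourierInv_eq]
  exact (memLp_symbol_mul (𝓕 f)).coeFn_toLp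

/-- `E₁` maps real functions to real functions. -/
theorem conj_E₁L2 {f : L2} (hf : f =ᵐ[volume] fun x => conj (f x)) :
    E₁L2 f =ᵐ[volume] fun x => conj (E₁L2 f x) := by
  have hm : MemLp (fun x => conj (E₁L2 f x)) 2 volume := (Lp.memLp (E₁L2 f)).star
  have hneg : MeasurePreserving (fun x : Plane => -x) volume volume :=
    Measure.measurePreserving_neg volume
  -- The transform of a real function is Hermitian, and multiplying it by a real even symbol keeps
  -- it so.
  have key : 𝓕 (hm.toLp _) = 𝓕 (E₁L2 f) := by
    refine Lp.ext ?_
    filter_upwards [fourier_conj (f := E₁L2 f) hm.coeFn_toLp, fourier_E₁L2 f, fourier_conj hf,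
      hneg.quasiMeasurePreserving.ae (fourier_E₁L2 f)] with ξ h1 h2 h3 h4
    rw [h1, h4, h2, h3, symbol_neg]
    simp
  have this : hm.toLp _ = E₁L2 f := (Lp.fourierTransformₗᵢ Plane ℂ).injective key
  have h2 := hm.coeFn_toLp
  rw [this] at h2
  exact h2

/-! ### Functions with square-integrable gradient -/

/-- The coordinate vectors of the plane. -/
def basisVec (i : Fin 2) : Plane := EuclideanSpace.single i 1

/-- The partial derivative in the direction of a coordinate vector. -/
def partialDeriv (i : Fin 2) (g : Plane → ℂ) : Plane → ℂ := fun x => fderiv ℝ g x (basisVec i)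

theorem inner_basisVec (i : Fin 2) (x : Plane) : ⟪x, basisVec i⟫ = x i := by
  simp [basisVec, EuclideanSpace.inner_single_right]

theorem inner_basisVec' (i : Fin 2) (x : Plane) : ⟪basisVec i, x⟫ = x i := by
  rw [real_inner_comm, inner_basisVec]

theorem norm_basisVec (i : Fin 2) : ‖basisVec i‖ = 1 := by simp [basisVec]

/-- `f` and `f'` are limits in `L²` of test functions and of their gradients. -/
structure HasGradient (f : Plane → ℂ) (f' : Fin 2 → Plane → ℂ) : Prop where
  memLp : MemLp f 2 volume
  memLp' : ∀ i, MemLp (f' i) 2 volume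
  approx : ∀ ε : ℝ≥0∞, 0 < ε → ∃ g : Plane → ℂ, ContDiff ℝ ((⊤ : ℕ∞) : WithTop ℕ∞) g ∧
    HasCompactSupport g ∧ eLpNorm (f - g) 2 volume ≤ ε ∧
    ∀ i, eLpNorm (f' i - partialDeriv i g) 2 volume ≤ ε

theorem hasGradient_of_tendsto {f : Plane → ℂ} {f' : Fin 2 → Plane → ℂ}
    (hf : MemLp f 2 volume) (hf' : ∀ i, MemLp (f' i) 2 volume) (g : ℕ → Plane → ℂ)
    (hg : ∀ n, ContDiff ℝ ((⊤ : ℕ∞) : WithTop ℕ∞) (g n)) (hgc : ∀ n, HasCompactSupport (g n))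
    (h : Tendsto (fun n => eLpNorm (f - g n) 2 volume) atTop (𝓝 0))
    (h' : ∀ i, Tendsto (fun n => eLpNorm (f' i - partialDeriv i (g n)) 2 volume) atTop (𝓝 0)) :
    HasGradient f f' := by
  refine ⟨hf, hf', fun ε hε => ?_⟩
  have h1 := (ENNReal.tendsto_nhds_zero.1 h ε hε).and
    (eventually_all.2 fun i => ENNReal.tendsto_nhds_zero.1 (h' i) ε hε)
  obtain ⟨n, hn⟩ := h1.exists
  exact ⟨g n, hg n, hgc n, hn.1, hn.2⟩

theorem HasGradient.exists_seq {f : Plane → ℂ} {f' : Fin 2 → Plane → ℂ} (h : HasGradient f f') :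
    ∃ g : ℕ → Plane → ℂ, (∀ n, ContDiff ℝ ((⊤ : ℕ∞) : WithTop ℕ∞) (g n)) ∧
      (∀ n, HasCompactSupport (g n)) ∧
      Tendsto (fun n => eLpNorm (f - g n) 2 volume) atTop (𝓝 0) ∧
      ∀ i, Tendsto (fun n => eLpNorm (f' i - partialDeriv i (g n)) 2 volume) atTop (𝓝 0) := by
  -- The value at n = 0 is ∞, which is an admissible tolerance.
  have hpos : ∀ n : ℕ, (0 : ℝ≥0∞) < (n : ℝ≥0∞)⁻¹ := fun n => by simp
  choose g hg hgc hgf hgf' using fun n : ℕ => h.approx _ (hpos n)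
  refine ⟨g, hg, hgc, ?_, fun i => ?_⟩
  · exact tendsto_of_tendsto_of_tendsto_of_le_of_le tendsto_const_nhds
      ENNReal.tendsto_inv_nat_nhds_zero (fun _ => zero_le) hgf
  · exact tendsto_of_tendsto_of_tendsto_of_le_of_le tendsto_const_nhds
      ENNReal.tendsto_inv_nat_nhds_zero (fun _ => zero_le) fun n => hgf' n i

theorem continuous_partialDeriv {g : Plane → ℂ} (hg : ContDiff ℝ ((⊤ : ℕ∞) : WithTop ℕ∞) g)
    (i : Fin 2) : Continuous (partialDeriv i g) :=
  (hg.continuous_fderiv (by simp)).clm_apply continuous_const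

theorem contDiff_partialDeriv {g : Plane → ℂ} (hg : ContDiff ℝ ((⊤ : ℕ∞) : WithTop ℕ∞) g)
    (i : Fin 2) : ContDiff ℝ ((⊤ : ℕ∞) : WithTop ℕ∞) (partialDeriv i g) :=
  (hg.fderiv_right (m := ((⊤ : ℕ∞) : WithTop ℕ∞)) (by simp)).clm_apply contDiff_const

theorem partialDeriv_ofReal_mul {k : Plane → ℝ} {f : Plane → ℂ} {x : Plane} {i : Fin 2}
    (hk : DifferentiableAt ℝ k x) (hf : DifferentiableAt ℝ f x) :
    partialDeriv i (fun x => (k x : ℂ) * f x) x =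
      (k x : ℂ) * partialDeriv i f x + (fderiv ℝ k x (basisVec i) : ℂ) * f x := by
  have h1 : HasFDerivAt (fun x => (k x : ℂ)) (Complex.ofRealCLM.comp (fderiv ℝ k x)) x :=
    Complex.ofRealCLM.hasFDerivAt.comp x hk.hasFDerivAt
  have h2 : HasFDerivAt (fun x => (k x : ℂ) * f x) _ x := h1.mul hf.hasFDerivAt
  simp only [partialDeriv, h2.fderiv]
  simp [mul_comm (f x)]

theorem hasCompactSupport_partialDeriv {g : Plane → ℂ} (hg : HasCompactSupport g) (i : Fin 2) :
    HasCompactSupport (partialDeriv i g) :=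
  hg.fderiv_apply (𝕜 := ℝ) _

theorem hasGradient_of_contDiff {g : Plane → ℂ} (hg : ContDiff ℝ ((⊤ : ℕ∞) : WithTop ℕ∞) g)
    (hgc : HasCompactSupport g) : HasGradient g fun i => partialDeriv i g :=
  ⟨hg.continuous.memLp_of_hasCompactSupport hgc,
    fun i => (continuous_partialDeriv hg i).memLp_of_hasCompactSupport
      (hasCompactSupport_partialDeriv hgc i),
    fun ε _ => ⟨g, hg, hgc, by simp, fun i => by simp⟩⟩

/-- A closure is closed: two approximations with tolerance ε/2 compose. Approximants then need not
have compact support, so Schwartz functions will do. -/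
theorem HasGradient.of_approx {f : Plane → ℂ} {f' : Fin 2 → Plane → ℂ}
    (hf : MemLp f 2 volume) (hf' : ∀ i, MemLp (f' i) 2 volume)
    (h : ∀ ε : ℝ≥0∞, 0 < ε → ∃ g g', HasGradient g g' ∧ eLpNorm (f - g) 2 volume ≤ ε ∧
      ∀ i, eLpNorm (f' i - g' i) 2 volume ≤ ε) : HasGradient f f' := by
  refine ⟨hf, hf', fun ε hε => ?_⟩
  obtain ⟨g, g', hg, h1, h2⟩ := h (ε / 2) (ENNReal.half_pos hε.ne')
  obtain ⟨k, hk, hkc, h3, h4⟩ := hg.approx (ε / 2) (ENNReal.half_pos hε.ne')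
  refine ⟨k, hk, hkc, ?_, fun i => ?_⟩
  · have e : f - k = (f - g) + (g - k) := by abel
    rw [e]
    refine (eLpNorm_add_le (hf.1.sub hg.memLp.1)
      (hg.memLp.1.sub hk.continuous.aestronglyMeasurable) (by norm_num)).trans ?_
    exact (add_le_add h1 h3).trans (ENNReal.add_halves ε).le
  · have e : f' i - partialDeriv i k = (f' i - g' i) + (g' i - partialDeriv i k) := by abel
    rw [e]
    refine (eLpNorm_add_le ((hf' i).1.sub (hg.memLp' i).1)
      ((hg.memLp' i).1.sub (continuous_partialDeriv hk i).aestronglyMeasurable)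
      (by norm_num)).trans ?_
    exact (add_le_add (h2 i) (h4 i)).trans (ENNReal.add_halves ε).le

theorem eLpNorm_one_add_norm_sq_mul_lt_top (f : 𝓢(Plane, ℂ)) :
    eLpNorm (fun x => ((1 + ‖x‖ ^ 2 : ℝ) : ℂ) * f x) 2 volume < ∞ := by
  have hT : (fun x : Plane => ((1 + ‖x‖ ^ 2 : ℝ) : ℂ)).HasTemperateGrowth := by fun_prop
  have h := (SchwartzMap.smulLeftCLM ℂ (fun x : Plane => ((1 + ‖x‖ ^ 2 : ℝ) : ℂ)) f).eLpNorm_lt_top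
    2 volume
  convert h using 3 with x
  rw [SchwartzMap.smulLeftCLM_apply_apply hT, smul_eq_mul]

theorem tendsto_inv_add_one_mul {C : ℝ≥0∞} (hC : C ≠ ∞) :
    Tendsto (fun n : ℕ => ENNReal.ofReal ((n : ℝ) + 1)⁻¹ * C) atTop (𝓝 0) := by
  have h : Tendsto (fun n : ℕ => ((n : ℝ) + 1)⁻¹) atTop (𝓝 0) := by
    simpa [one_div] using tendsto_one_div_add_atTop_nhds_zero_nat (𝕜 := ℝ)
  have h2 := ENNReal.Tendsto.mul_const (ENNReal.tendsto_ofReal h) (b := C) (Or.inr hC)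
  simpa using h2

/-- Cut off with χ(r x), where r = 1/(n + 1). The cutoff error satisfies |1 - χ(r x)| ≤ r(1 + |x|²)
and the gradient of the cutoff is O(r). Schwartz decay absorbs the weight 1 + |x|², so all errors
are O(r) in L². -/
theorem hasGradient_schwartz (f : 𝓢(Plane, ℂ)) : HasGradient f fun i => partialDeriv i f := by
  let χ : ContDiffBump (0 : Plane) := ⟨1, 2, one_pos, one_lt_two⟩
  have hχ : ContDiff ℝ ((⊤ : ℕ∞) : WithTop ℕ∞) χ := χ.contDiff
  let r : ℕ → ℝ := fun n => ((n : ℝ) + 1)⁻¹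
  have hr : ∀ n, 0 < r n := fun n => by positivity
  have hr1 : ∀ n, r n ≤ 1 := fun n => inv_le_one_of_one_le₀ (by simp)
  let k : ℕ → Plane → ℝ := fun n x => χ (r n • x)
  have hk : ∀ n, ContDiff ℝ ((⊤ : ℕ∞) : WithTop ℕ∞) (k n) := fun n =>
    hχ.comp (contDiff_const_smul (r n))
  have hkc : ∀ n, HasCompactSupport (k n) := fun n =>
    χ.hasCompactSupport.comp_homeomorph (Homeomorph.smulOfNeZero (r n) (hr n).ne')
  have hk1 : ∀ n x, |1 - k n x| ≤ r n * (1 + ‖x‖ ^ 2) := fun n x => by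
    by_cases hx : ‖r n • x‖ ≤ 1
    · have : k n x = 1 := χ.one_of_mem_closedBall (by simpa [χ] using hx)
      rw [this, sub_self, abs_zero]
      have := hr n
      positivity
    -- Here r|x| > 1, so the left side is at most 1 < r|x| ≤ r(1 + |x|²).
    · have h0 : 0 ≤ k n x := χ.nonneg
      have h1 : k n x ≤ 1 := χ.le_one
      rw [abs_of_nonneg (by linarith)]
      rw [norm_smul, Real.norm_of_nonneg (hr n).le, not_le] at hx
      nlinarith [hr n, sq_nonneg (‖x‖ - 1), norm_nonneg x]
  obtain ⟨K, hK⟩ : ∃ K, ∀ x, ‖fderiv ℝ χ x‖ ≤ K :=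
    (χ.hasCompactSupport.fderiv (𝕜 := ℝ)).exists_bound_of_continuous
      (hχ.continuous_fderiv (by simp))
  have hK0 : 0 ≤ K := (norm_nonneg _).trans (hK 0)
  have hkd : ∀ n x v, ‖fderiv ℝ (k n) x v‖ ≤ r n * K * ‖v‖ := fun n x v => by
    have h1 : HasFDerivAt (k n) ((fderiv ℝ χ (r n • x)).comp (r n • ContinuousLinearMap.id ℝ Plane))
        x := ((hχ.differentiable (by simp)) _).hasFDerivAt.comp x
          ((hasFDerivAt_id x).const_smul (r n))
    rw [h1.fderiv]
    simp only [ContinuousLinearMap.comp_apply, smul_apply,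
      ContinuousLinearMap.id_apply, map_smul, norm_smul, Real.norm_of_nonneg (hr n).le, mul_assoc]
    gcongr
    exact (ContinuousLinearMap.le_opNorm _ _).trans (by gcongr; exact hK _)
  have hfi : ∀ i, MemLp (partialDeriv i f) 2 volume := fun i =>
    (LineDeriv.lineDerivOp (basisVec i) f).memLp 2 volume
  refine hasGradient_of_tendsto (f.memLp 2 volume) hfi
    (fun n x => (k n x : ℂ) * f x) (fun n => ?_) (fun n => ?_) ?_ fun i => ?_
  · exact (Complex.ofRealCLM.contDiff.comp (hk n)).mul (f.smooth ⊤)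
  · exact ((hkc n).comp_left Complex.ofReal_zero).mul_right
  · refine tendsto_of_tendsto_of_tendsto_of_le_of_le tendsto_const_nhds
      (tendsto_inv_add_one_mul (eLpNorm_one_add_norm_sq_mul_lt_top f).ne) (fun _ => zero_le)
      fun n => ?_
    refine eLpNorm_le_mul_eLpNorm_of_ae_le_mul (Eventually.of_forall fun x => ?_) 2
    have e : (f - fun x => (k n x : ℂ) * f x) x = ((1 - k n x : ℝ) : ℂ) * f x := by
      simp; ring
    rw [e, norm_mul, norm_mul, Complex.norm_real, Complex.norm_real, ← mul_assoc]
    gcongr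
    rw [Real.norm_eq_abs, Real.norm_of_nonneg (by positivity)]
    exact hk1 n x
  · let f₁ := LineDeriv.lineDerivOp (basisVec i) f
    have hf₁ : ∀ x, f₁ x = fderiv ℝ f x (basisVec i) := fun x => rfl
    have hC : eLpNorm (fun x => ((1 + ‖x‖ ^ 2 : ℝ) : ℂ) * f₁ x) 2 volume +
        ENNReal.ofReal K * eLpNorm f 2 volume ≠ ∞ :=
      (ENNReal.add_lt_top.2 ⟨eLpNorm_one_add_norm_sq_mul_lt_top f₁,
        ENNReal.mul_lt_top ENNReal.ofReal_lt_top (f.eLpNorm_lt_top 2 volume)⟩).ne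
    refine tendsto_of_tendsto_of_tendsto_of_le_of_le tendsto_const_nhds
      (tendsto_inv_add_one_mul hC) (fun _ => zero_le) fun n => ?_
    have e : (partialDeriv i f - partialDeriv i fun x => (k n x : ℂ) * f x) =
        (fun x => ((1 - k n x : ℝ) : ℂ) * f₁ x) -
          fun x => (fderiv ℝ (k n) x (basisVec i) : ℂ) * f x := by
      ext x
      rw [Pi.sub_apply, Pi.sub_apply, partialDeriv_ofReal_mul ((hk n).differentiable (by simp) x)
        f.differentiableAt, hf₁, partialDeriv]
      push_cast
      ring
    have hc1 : Continuous fun x => ((1 - k n x : ℝ) : ℂ) * f₁ x :=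
      (Complex.continuous_ofReal.comp (continuous_const.sub (hk n).continuous)).mul f₁.continuous
    have hc2 : Continuous fun x => (fderiv ℝ (k n) x (basisVec i) : ℂ) * f x :=
      (Complex.continuous_ofReal.comp
        (((hk n).continuous_fderiv (by simp)).clm_apply continuous_const)).mul f.continuous
    rw [e]
    refine (eLpNorm_sub_le hc1.aestronglyMeasurable hc2.aestronglyMeasurable (by norm_num)).trans ?_
    rw [mul_add, ← mul_assoc, ← ENNReal.ofReal_mul (hr n).le]
    refine add_le_add (eLpNorm_le_mul_eLpNorm_of_ae_le_mul (Eventually.of_forall fun x => ?_) 2)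
      (eLpNorm_le_mul_eLpNorm_of_ae_le_mul (Eventually.of_forall fun x => ?_) 2)
    · rw [norm_mul, norm_mul, Complex.norm_real, Complex.norm_real, ← mul_assoc]
      gcongr
      rw [Real.norm_eq_abs, Real.norm_of_nonneg (by positivity)]
      exact hk1 n x
    · rw [norm_mul, Complex.norm_real]
      gcongr
      simpa [norm_basisVec] using hkd n x (basisVec i)

/-! ### From the Fourier definition of `H¹` to a gradient -/

theorem fourier_sub' (f g : L2) : 𝓕 (f - g) = 𝓕 f - 𝓕 g :=
  map_sub (Lp.fourierTransformₗᵢ Plane ℂ) f g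

theorem norm_le_of_ae_eq_mul {F G : L2} {b : Plane → ℂ} {C : ℝ}
    (h : F =ᵐ[volume] fun ξ => b ξ * G ξ) (hb : ∀ ξ, ‖b ξ‖ ≤ C) : ‖F‖ ≤ C * ‖G‖ := by
  refine Lp.norm_le_mul_norm_of_ae_le_mul ?_
  filter_upwards [h] with ξ hξ
  rw [hξ, norm_mul]
  gcongr
  exact hb ξ

theorem memLp_bounded_mul {b : Plane → ℂ} (hb : Continuous b) {C : ℝ} (hC : ∀ ξ, ‖b ξ‖ ≤ C)
    (G : L2) : MemLp (fun ξ => b ξ * G ξ) 2 volume :=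
  (Lp.memLp G).of_le_mul (hb.aestronglyMeasurable.mul (Lp.aestronglyMeasurable G))
    (Eventually.of_forall fun ξ => by rw [norm_mul]; gcongr; exact hC ξ)

/-- The weight `(1 + |ξ|²)^{-1/2}`. -/
def weight (ξ : Plane) : ℂ := (((1 + ‖ξ‖ ^ 2) ^ (-(1 / 2) : ℝ) : ℝ) : ℂ)

theorem hasTemperateGrowth_weight : weight.HasTemperateGrowth := by
  unfold weight
  fun_prop

theorem norm_weight (ξ : Plane) : ‖weight ξ‖ ^ 2 * (1 + ‖ξ‖ ^ 2) = 1 := by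
  have h : 0 < 1 + ‖ξ‖ ^ 2 := by positivity
  rw [weight, Complex.norm_real, Real.norm_of_nonneg (by positivity), ← Real.rpow_natCast,
    ← Real.rpow_mul h.le]
  norm_num
  rw [Real.rpow_neg_one, inv_mul_cancel₀ h.ne']

theorem norm_weight_le (ξ : Plane) : ‖weight ξ‖ ≤ 1 := by
  nlinarith [norm_weight ξ, norm_nonneg (weight ξ), sq_nonneg (‖weight ξ‖ * ‖ξ‖)]

theorem norm_coord_mul_weight_le (i : Fin 2) (ξ : Plane) :
    ‖(2 * π * Complex.I * (ξ i : ℂ)) * weight ξ‖ ≤ 2 * π := by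
  have h : |ξ i| ≤ ‖ξ‖ := PiLp.norm_apply_le ξ i
  have h2 : |ξ i| * ‖weight ξ‖ ≤ 1 := by
    refine abs_le_of_sq_le_sq' ?_ zero_le_one |>.2
    rw [mul_pow, one_pow]
    have := norm_weight ξ
    have h3 : |ξ i| ^ 2 ≤ ‖ξ‖ ^ 2 := by gcongr
    nlinarith [sq_nonneg ‖weight ξ‖]
  have : ‖(2 * π * Complex.I * (ξ i : ℂ)) * weight ξ‖ = 2 * π * (|ξ i| * ‖weight ξ‖) := by
    simp [abs_of_pos pi_pos]; ring
  rw [this]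
  have := pi_pos
  nlinarith

/-- A function in `H¹` has a gradient, whose Fourier transform is `2πi ξ 𝓕u`. -/
theorem exists_hasGradient {u : L2}
    (hu : TemperedDistribution.MemSobolev 1 2 (u : 𝓢'(Plane, ℂ))) :
    ∃ v : Fin 2 → L2, HasGradient u (fun i => v i) ∧
      ∀ i, (𝓕 (v i) : L2) =ᵐ[volume]
        fun ξ => (2 * π * Complex.I * (ξ i : ℂ)) * (𝓕 u : L2) ξ := by
  -- G is (1 + |ξ|²)^{1/2} 𝓕u. Both 𝓕u and 2πi ξ_i 𝓕u are bounded multipliers applied to G, so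
  -- approximating G in L² approximates u together with its gradient.
  obtain ⟨G, hG⟩ := TemperedDistribution.memSobolev_iff_exists_smulLeftCLM_fourier.1 hu
  have hwc : Continuous weight := hasTemperateGrowth_weight.1.continuous
  let c : Fin 2 → Plane → ℂ := fun i ξ => (2 * π * Complex.I * (ξ i : ℂ)) * weight ξ
  have hcc : ∀ i, Continuous (c i) := fun i => by
    simp only [c]
    fun_prop
  have hm0 : ∀ G : L2, MemLp (fun ξ => weight ξ * G ξ) 2 volume :=
    memLp_bounded_mul hwc norm_weight_le
  have hm : ∀ i (G : L2), MemLp (fun ξ => c i ξ * G ξ) 2 volume := fun i =>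
    memLp_bounded_mul (hcc i) (norm_coord_mul_weight_le i)
  have hFu : (𝓕 u : L2) = (hm0 G).toLp _ := by
    refine toTemperedDistribution_injective fun φ => ?_
    -- Testing against `weight` times φ divides out the factor (1 + |ξ|²)^{1/2}.
    have h1 := DFunLike.congr_fun hG (SchwartzMap.smulLeftCLM ℂ weight φ)
    rw [Lp.fourier_toTemperedDistribution_eq, TemperedDistribution.smulLeftCLM_apply_apply,
      SchwartzMap.smulLeftCLM_smulLeftCLM_apply (by fun_prop) hasTemperateGrowth_weight] at h1
    have e : ((fun x : Plane => (((1 + ‖x‖ ^ 2) ^ ((1 : ℝ) / 2) : ℝ) : ℂ)) * weight) = fun _ => 1 := by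
      ext x
      simp only [Pi.mul_apply, weight]
      rw [← Complex.ofReal_mul, ← Real.rpow_add (by positivity)]
      simp
    rw [e] at h1
    simp only [Lp.toTemperedDistribution_apply, SchwartzMap.smulLeftCLM_const, smul_eq_mul,
      SchwartzMap.smulLeftCLM_apply_apply hasTemperateGrowth_weight] at h1
    refine (Eq.trans ?_ h1).trans ?_
    · rw [one_smul]; rfl
    refine integral_congr_ae ?_
    filter_upwards [(hm0 G).coeFn_toLp] with ξ hξ
    rw [hξ]; ring
  let v : Fin 2 → L2 := fun i => 𝓕⁻ ((hm i G).toLp _)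
  have hFv : ∀ i, (𝓕 (v i) : L2) = (hm i G).toLp _ := fun i => fourier_fourierInv_eq _
  refine ⟨v, ?_, fun i => ?_⟩
  · refine HasGradient.of_approx (Lp.memLp _) (fun i => Lp.memLp _) fun ε hε => ?_
    -- The two multipliers are bounded by 1 and by 2π, which fixes the two smallness conditions on
    -- δ.
    obtain ⟨δ, hδ, hδε⟩ : ∃ δ : ℝ, 0 < δ ∧ ENNReal.ofReal (2 * π * δ) ≤ ε ∧ ENNReal.ofReal δ ≤ ε := by
      rcases eq_or_ne ε ∞ with rfl | hε'
      · exact ⟨1, one_pos, le_top, le_top⟩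
      · have h0 := ENNReal.toReal_pos hε.ne' hε'
        have := pi_gt_three
        refine ⟨ε.toReal / (2 * π), by positivity, ?_, ?_⟩
        · rw [mul_div_cancel₀ _ (by positivity), ENNReal.ofReal_toReal hε']
        · refine ENNReal.ofReal_le_of_le_toReal (div_le_self h0.le (by linarith))
    obtain ⟨γ, hγ⟩ := (SchwartzMap.denseRange_toLpCLM (E := Plane) (F := ℂ) (p := 2)
      (μ := volume) ENNReal.ofNat_ne_top).exists_dist_lt G hδ
    rw [SchwartzMap.toLpCLM_apply, dist_eq_norm] at hγ
    -- The weight is smooth of temperate growth, so w is Schwartz; u - w and v_i - ∂_i w are, in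
    -- frequency, the bounded multipliers applied to G - γ.
    let w : 𝓢(Plane, ℂ) := 𝓕⁻ (SchwartzMap.smulLeftCLM ℂ weight γ)
    have hw : 𝓕 w = SchwartzMap.smulLeftCLM ℂ weight γ := fourier_fourierInv_eq _
    refine ⟨w, _, hasGradient_schwartz w, ?_, fun i => ?_⟩
    · have h1 : ‖u - w.toLp 2 volume‖ ≤ 1 * ‖G - γ.toLp 2 volume‖ := by
        rw [← Lp.norm_fourier_eq]
        refine norm_le_of_ae_eq_mul (b := weight) ?_ norm_weight_le
        rw [fourier_sub', hFu, SchwartzMap.toLp_fourier_eq, hw]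
        filter_upwards [Lp.coeFn_sub ((hm0 G).toLp _)
          ((SchwartzMap.smulLeftCLM ℂ weight γ).toLp 2 volume), (hm0 G).coeFn_toLp,
          (SchwartzMap.smulLeftCLM ℂ weight γ).coeFn_toLp 2 volume, γ.coeFn_toLp 2 volume,
          Lp.coeFn_sub G (γ.toLp 2 volume)] with ξ h1 h2 h3 h4 h5
        rw [h1, Pi.sub_apply, h2, h3, h5, Pi.sub_apply, h4,
          SchwartzMap.smulLeftCLM_apply_apply hasTemperateGrowth_weight, smul_eq_mul]
        ring
      have h2 : eLpNorm ((u : Plane → ℂ) - (w : Plane → ℂ)) 2 volume = ENNReal.ofReal ‖u - w.toLp 2 volume‖ := by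
        rw [Lp.norm_def, ENNReal.ofReal_toReal (Lp.eLpNorm_ne_top _)]
        refine eLpNorm_congr_ae ?_
        filter_upwards [Lp.coeFn_sub u (w.toLp 2 volume), w.coeFn_toLp 2 volume] with x h1 h2
        rw [h1, Pi.sub_apply, Pi.sub_apply, h2]
      rw [h2]
      exact (ENNReal.ofReal_le_ofReal (by linarith)).trans hδε.2
    · let w' := LineDeriv.lineDerivOp (basisVec i) w
      have hw' : ∀ ξ, (𝓕 w') ξ = c i ξ * γ ξ := fun ξ => by
        rw [SchwartzMap.fourier_lineDerivOp_eq, hw]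
        have hT : (fun x : Plane => (inner ℝ x (basisVec i))).HasTemperateGrowth := by fun_prop
        simp only [smul_apply]
        rw [SchwartzMap.smulLeftCLM_apply_apply hT,
          SchwartzMap.smulLeftCLM_apply_apply hasTemperateGrowth_weight, inner_basisVec]
        simp only [c, smul_eq_mul, Complex.real_smul]
        ring
      have h1 : ‖v i - w'.toLp 2 volume‖ ≤ (2 * π) * ‖G - γ.toLp 2 volume‖ := by
        rw [← Lp.norm_fourier_eq]
        refine norm_le_of_ae_eq_mul (b := c i) ?_ (norm_coord_mul_weight_le i)
        rw [fourier_sub', hFv, SchwartzMap.toLp_fourier_eq]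
        filter_upwards [Lp.coeFn_sub ((hm i G).toLp _)
          ((𝓕 w').toLp 2 volume), (hm i G).coeFn_toLp,
          (𝓕 w').coeFn_toLp 2 volume, γ.coeFn_toLp 2 volume,
          Lp.coeFn_sub G (γ.toLp 2 volume)] with ξ h1 h2 h3 h4 h5
        rw [h1, Pi.sub_apply, h2, h3, h5, Pi.sub_apply, h4, hw']
        ring
      have h2 : eLpNorm ((v i : Plane → ℂ) - partialDeriv i w) 2 volume = ENNReal.ofReal ‖v i - w'.toLp 2 volume‖ := by
        rw [Lp.norm_def, ENNReal.ofReal_toReal (Lp.eLpNorm_ne_top _)]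
        refine eLpNorm_congr_ae ?_
        filter_upwards [Lp.coeFn_sub (v i) (w'.toLp 2 volume), w'.coeFn_toLp 2 volume] with x h1 h2
        rw [h1, Pi.sub_apply, Pi.sub_apply, h2]
        rfl
      rw [h2]
      refine (ENNReal.ofReal_le_ofReal ?_).trans hδε.1
      exact h1.trans (by gcongr)
  · rw [hFv, hFu]
    filter_upwards [(hm i G).coeFn_toLp, (hm0 G).coeFn_toLp] with ξ h1 h2
    rw [h1, h2]
    simp only [c]
    ring

/-! ### Operations on functions with a gradient -/

theorem HasGradient.sub {f g : Plane → ℂ} {f' g' : Fin 2 → Plane → ℂ}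
    (hf : HasGradient f f') (hg : HasGradient g g') :
    HasGradient (fun x => f x - g x) fun i x => f' i x - g' i x := by
  refine ⟨hf.memLp.sub hg.memLp, fun i => (hf.memLp' i).sub (hg.memLp' i), fun ε hε => ?_⟩
  obtain ⟨k, hk, hkc, h1, h2⟩ := hf.approx (ε / 2) (ENNReal.half_pos hε.ne')
  obtain ⟨l, hl, hlc, h3, h4⟩ := hg.approx (ε / 2) (ENNReal.half_pos hε.ne')
  refine ⟨k - l, hk.sub hl, hkc.sub hlc, ?_, fun i => ?_⟩
  · have e : (fun x => f x - g x) - (k - l) = (f - k) - (g - l) := by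
      ext x; simp only [Pi.sub_apply]; ring
    rw [e]
    refine (eLpNorm_sub_le (hf.memLp.1.sub hk.continuous.aestronglyMeasurable)
      (hg.memLp.1.sub hl.continuous.aestronglyMeasurable) (by norm_num)).trans ?_
    exact (add_le_add h1 h3).trans (ENNReal.add_halves ε).le
  · have e : (fun x => f' i x - g' i x) - partialDeriv i (k - l) =
        (f' i - partialDeriv i k) - (g' i - partialDeriv i l) := by
      ext x
      simp only [Pi.sub_apply, partialDeriv]
      rw [fderiv_sub (hk.differentiable (by simp) x) (hl.differentiable (by simp) x)]
      simp only [sub_apply]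
      ring
    rw [e]
    refine (eLpNorm_sub_le ((hf.memLp' i).1.sub (continuous_partialDeriv hk i).aestronglyMeasurable)
      ((hg.memLp' i).1.sub (continuous_partialDeriv hl i).aestronglyMeasurable)
      (by norm_num)).trans ?_
    exact (add_le_add (h2 i) (h4 i)).trans (ENNReal.add_halves ε).le

theorem eLpNorm_comp_add {E : Type*} [NormedAddCommGroup E] {f : Plane → E} {p : ℝ≥0∞}
    (hf : AEStronglyMeasurable f volume) (h : Plane) : eLpNorm (fun x => f (x + h)) p volume = eLpNorm f p volume :=
  eLpNorm_comp_measurePreserving hf (measurePreserving_add_const h)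

theorem memLp_comp_add {E : Type*} [NormedAddCommGroup E] {f : Plane → E} {p : ℝ≥0∞}
    (hf : MemLp f p volume) (h : Plane) : MemLp (fun x => f (x + h)) p volume :=
  hf.comp_measurePreserving (measurePreserving_add_const h)

theorem HasGradient.comp_add {f : Plane → ℂ} {f' : Fin 2 → Plane → ℂ}
    (hf : HasGradient f f') (h : Plane) :
    HasGradient (fun x => f (x + h)) fun i x => f' i (x + h) := by
  refine ⟨memLp_comp_add hf.memLp h, fun i => memLp_comp_add (hf.memLp' i) h, fun ε hε => ?_⟩
  obtain ⟨k, hk, hkc, h1, h2⟩ := hf.approx ε hε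
  refine ⟨fun x => k (x + h), hk.comp (contDiff_id.add contDiff_const),
    hkc.comp_homeomorph (Homeomorph.addRight h), ?_, fun i => ?_⟩
  · exact (eLpNorm_comp_add (hf.memLp.1.sub hk.continuous.aestronglyMeasurable) h).trans_le h1
  · have e : (fun x => f' i (x + h)) - partialDeriv i (fun x => k (x + h)) =
        fun x => (f' i - partialDeriv i k) (x + h) := by
      ext x
      simp only [Pi.sub_apply, partialDeriv, fderiv_comp_add_right]
    rw [e]
    exact (eLpNorm_comp_add ((hf.memLp' i).1.sub
      (continuous_partialDeriv hk i).aestronglyMeasurable) h).trans_le (h2 i)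

theorem HasGradient.conj {f : Plane → ℂ} {f' : Fin 2 → Plane → ℂ}
    (hf : HasGradient f f') :
    HasGradient (fun x => conj (f x)) fun i x => conj (f' i x) := by
  refine ⟨hf.memLp.star, fun i => (hf.memLp' i).star, fun ε hε => ?_⟩
  obtain ⟨k, hk, hkc, h1, h2⟩ := hf.approx ε hε
  refine ⟨fun x => starRingEnd ℂ (k x), Complex.conjCLE.contDiff.comp hk,
    hkc.comp_left (map_zero _), ?_, fun i => ?_⟩
  · refine (eLpNorm_congr_norm_ae (Eventually.of_forall fun x => ?_)).trans_le h1
    simp only [Pi.sub_apply, ← map_sub, RCLike.norm_conj]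
  · refine (eLpNorm_congr_norm_ae (Eventually.of_forall fun x => ?_)).trans_le (h2 i)
    have hd : HasFDerivAt (fun x => starRingEnd ℂ (k x))
        ((Complex.conjCLE : ℂ →L[ℝ] ℂ).comp (fderiv ℝ k x)) x :=
      Complex.conjCLE.hasFDerivAt.comp x (hk.differentiable (by simp) x).hasFDerivAt
    have e : partialDeriv i (fun x => starRingEnd ℂ (k x)) x = starRingEnd ℂ (partialDeriv i k x) := by
      simp only [partialDeriv, hd.fderiv]
      simp
    simp only [Pi.sub_apply, e, ← map_sub, RCLike.norm_conj]

/-- The product rule survives the L² limit because φ and its partial derivatives are bounded. This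
makes the sine weight times the conjugate of an increment of u an admissible test function. -/
theorem HasGradient.ofReal_mul {f : Plane → ℂ} {f' : Fin 2 → Plane → ℂ}
    (hf : HasGradient f f') {φ : Plane → ℝ} (hφ : ContDiff ℝ ((⊤ : ℕ∞) : WithTop ℕ∞) φ) {M : ℝ}
    (hM : ∀ x, |φ x| ≤ M) (hM' : ∀ i x, |fderiv ℝ φ x (basisVec i)| ≤ M) :
    HasGradient (fun x => (φ x : ℂ) * f x)
      fun i x => (φ x : ℂ) * f' i x + (fderiv ℝ φ x (basisVec i) : ℂ) * f x := by
  have hM0 : 0 ≤ M := (abs_nonneg _).trans (hM 0)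
  have hc : Continuous fun x => (φ x : ℂ) := Complex.continuous_ofReal.comp hφ.continuous
  have hc' : ∀ i, Continuous fun x => (fderiv ℝ φ x (basisVec i) : ℂ) := fun i =>
    Complex.continuous_ofReal.comp ((hφ.continuous_fderiv (by simp)).clm_apply continuous_const)
  have b1 : ∀ {q : Plane → ℂ}, MemLp q 2 volume → MemLp (fun x => (φ x : ℂ) * q x) 2 volume :=
    fun {q} hq => hq.of_le_mul (c := M) (hc.aestronglyMeasurable.mul hq.1)
      (Eventually.of_forall fun x => by
        rw [norm_mul, Complex.norm_real]; gcongr; exact hM x)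
  have b2 : ∀ {q : Plane → ℂ} (i), MemLp q 2 volume →
      MemLp (fun x => (fderiv ℝ φ x (basisVec i) : ℂ) * q x) 2 volume :=
    fun {q} i hq => hq.of_le_mul (c := M) ((hc' i).aestronglyMeasurable.mul hq.1)
      (Eventually.of_forall fun x => by
        rw [norm_mul, Complex.norm_real]; gcongr; exact hM' i x)
  obtain ⟨g, hg, hgc, h1, h2⟩ := hf.exists_seq
  have hz : ∀ {s : ℕ → ℝ≥0∞}, Tendsto s atTop (𝓝 0) →
      Tendsto (fun n => ENNReal.ofReal M * s n) atTop (𝓝 0) := fun {s} hs => by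
    simpa using ENNReal.Tendsto.const_mul hs (Or.inr ENNReal.ofReal_ne_top)
  refine hasGradient_of_tendsto (b1 hf.memLp) (fun i => (b1 (hf.memLp' i)).add (b2 i hf.memLp))
    (fun n x => (φ x : ℂ) * g n x) (fun n => (Complex.ofRealCLM.contDiff.comp hφ).mul (hg n))
    (fun n => (hgc n).mul_left) ?_ fun i => ?_
  · refine tendsto_of_tendsto_of_tendsto_of_le_of_le tendsto_const_nhds (hz h1)
      (fun _ => zero_le) fun n => ?_
    refine eLpNorm_le_mul_eLpNorm_of_ae_le_mul (Eventually.of_forall fun x => ?_) 2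
    simp only [Pi.sub_apply, ← mul_sub, norm_mul, Complex.norm_real]
    gcongr
    exact hM x
  · have h3 := (hz (h2 i)).add (hz h1)
    rw [add_zero] at h3
    refine tendsto_of_tendsto_of_tendsto_of_le_of_le tendsto_const_nhds h3
      (fun _ => zero_le) fun n => ?_
    have e : (fun x => (φ x : ℂ) * f' i x + (fderiv ℝ φ x (basisVec i) : ℂ) * f x) -
        partialDeriv i (fun x => (φ x : ℂ) * g n x) =
        (fun x => (φ x : ℂ) * (f' i - partialDeriv i (g n)) x) +
          fun x => (fderiv ℝ φ x (basisVec i) : ℂ) * (f - g n) x := by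
      ext x
      rw [Pi.sub_apply, partialDeriv_ofReal_mul (hφ.differentiable (by simp) x)
        ((hg n).differentiable (by simp) x)]
      simp only [Pi.add_apply, Pi.sub_apply]
      ring
    rw [e]
    refine (eLpNorm_add_le
      (hc.aestronglyMeasurable.mul ((hf.memLp' i).1.sub
        (continuous_partialDeriv (hg n) i).aestronglyMeasurable))
      ((hc' i).aestronglyMeasurable.mul (hf.memLp.1.sub
        (hg n).continuous.aestronglyMeasurable)) (by norm_num)).trans ?_
    refine add_le_add (eLpNorm_le_mul_eLpNorm_of_ae_le_mul (Eventually.of_forall fun x => ?_) 2)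
      (eLpNorm_le_mul_eLpNorm_of_ae_le_mul (Eventually.of_forall fun x => ?_) 2)
    · rw [Pi.mul_apply, norm_mul, Complex.norm_real]
      gcongr
      exact hM x
    · rw [Pi.mul_apply, norm_mul, Complex.norm_real]
      gcongr
      exact hM' i x

/-! ### The embedding of `H¹` into `L⁴` -/

instance holderTriple_four_four_two : ENNReal.HolderTriple 4 4 2 where
  inv_add_inv_eq_inv := by
    rw [← two_mul, show (4 : ℝ≥0∞) = 2 * 2 by norm_num,
      ENNReal.mul_inv (Or.inl (by norm_num)) (Or.inl (by norm_num)), ← mul_assoc,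
      ENNReal.mul_inv_cancel (by norm_num) (by norm_num), one_mul]

theorem eLpNorm_le_mul_mul {E F G : Type*} [NormedAddCommGroup E] [NormedAddCommGroup F]
    [NormedAddCommGroup G] {k : Plane → E} {f : Plane → F} {g : Plane → G} {p q r : ℝ≥0∞}
    [ENNReal.HolderTriple p q r] (hf : AEStronglyMeasurable f volume)
    (hg : AEStronglyMeasurable g volume) {C : ℝ}
    (h : ∀ᵐ x, ‖k x‖ ≤ C * (‖f x‖ * ‖g x‖)) :
    eLpNorm k r volume ≤ ENNReal.ofReal C * (eLpNorm f p volume * eLpNorm g q volume) := by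
  have h1 : eLpNorm k r volume ≤
      ENNReal.ofReal C * eLpNorm (fun x => ‖f x‖ * ‖g x‖) r volume := by
    refine eLpNorm_le_mul_eLpNorm_of_ae_le_mul ?_ r
    filter_upwards [h] with x hx
    rwa [norm_mul, norm_norm, norm_norm]
  refine h1.trans ?_
  gcongr
  have h2 := eLpNorm_smul_le_mul_eLpNorm (p := p) (q := q) (r := r) hg.norm hf.norm
  simp only [eLpNorm_norm] at h2
  exact h2

/-- Cauchy–Schwarz applied to ∇(g²) = 2g∇g, in preparation for a Sobolev inequality for g² rather
than g. -/
theorem eLpNorm_fderiv_sq_le {g : Plane → ℂ} (hg : ContDiff ℝ ((⊤ : ℕ∞) : WithTop ℕ∞) g) :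
    eLpNorm (fderiv ℝ (fun x => g x * g x)) 1 volume ≤
      2 * (eLpNorm g 2 volume * ∑ i, eLpNorm (partialDeriv i g) 2 volume) := by
  have hm : ∀ i, AEStronglyMeasurable (partialDeriv i g) volume := fun i =>
    (continuous_partialDeriv hg i).aestronglyMeasurable
  let N : Plane → ℝ := fun x => ‖partialDeriv 0 g x‖ + ‖partialDeriv 1 g x‖
  have hN : AEStronglyMeasurable N volume := (hm 0).norm.add (hm 1).norm
  have h1 : eLpNorm (fderiv ℝ (fun x => g x * g x)) 1 volume ≤
      ENNReal.ofReal 2 * (eLpNorm g 2 volume * eLpNorm N 2 volume) := by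
    refine eLpNorm_le_mul_mul hg.continuous.aestronglyMeasurable hN
      (Eventually.of_forall fun x => ?_)
    have hd : HasFDerivAt (fun x => g x * g x) _ x :=
      (hg.differentiable (by simp) x).hasFDerivAt.mul (hg.differentiable (by simp) x).hasFDerivAt
    rw [hd.fderiv, ← two_smul ℝ, norm_smul, norm_smul, Real.norm_of_nonneg two_pos.le]
    gcongr
    rw [Real.norm_of_nonneg (by positivity)]
    refine ContinuousLinearMap.opNorm_le_bound _ (by positivity) fun y => ?_
    have hy : y = y 0 • basisVec 0 + y 1 • basisVec 1 := by
      ext i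
      fin_cases i <;> simp [basisVec]
    have h0 : ∀ i, |y i| ≤ ‖y‖ := fun i => PiLp.norm_apply_le y i
    calc ‖fderiv ℝ g x y‖ = ‖y 0 • partialDeriv 0 g x + y 1 • partialDeriv 1 g x‖ := by
          conv_lhs => rw [hy]
          simp only [map_add, map_smul, partialDeriv]
      _ ≤ |y 0| * ‖partialDeriv 0 g x‖ + |y 1| * ‖partialDeriv 1 g x‖ := by
          refine (norm_add_le _ _).trans ?_
          rw [norm_smul, norm_smul, Real.norm_eq_abs, Real.norm_eq_abs]
      _ ≤ ‖y‖ * ‖partialDeriv 0 g x‖ + ‖y‖ * ‖partialDeriv 1 g x‖ := by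
          gcongr <;> exact h0 _
      _ = _ := by ring
  refine h1.trans ?_
  rw [ENNReal.ofReal_ofNat, Fin.sum_univ_two]
  gcongr
  refine (eLpNorm_add_le (hm 0).norm (hm 1).norm (by norm_num)).trans ?_
  simp only [eLpNorm_norm, le_refl]

/-- Ladyzhenskaya's inequality. -/
theorem exists_eLpNorm_four_le : ∃ C : ℝ≥0∞, C ≠ ∞ ∧ ∀ {f : Plane → ℂ} {f' : Fin 2 → Plane → ℂ},
    HasGradient f f' → eLpNorm f 4 volume ^ 2 ≤
      C * (eLpNorm f 2 volume * ∑ i, eLpNorm (f' i) 2 volume) := by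
  have hconj : NNReal.HolderConjugate (Module.finrank ℝ Plane) (2 : NNReal) := by
    rw [finrank_euclideanSpace_fin]
    push_cast
    exact ⟨by norm_num, by norm_num, by norm_num⟩
  set K : ℝ≥0∞ := (eLpNormLESNormFDerivOneConst (volume : Measure Plane) (2 : NNReal) : ℝ≥0∞)
  have hsm : ∀ {g : Plane → ℂ}, ContDiff ℝ ((⊤ : ℕ∞) : WithTop ℕ∞) g → HasCompactSupport g →
      eLpNorm g 4 volume ^ 2 ≤
        K * 2 * (eLpNorm g 2 volume * ∑ i, eLpNorm (partialDeriv i g) 2 volume) := by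
    intro g hg hgc
    -- In the plane the L¹ norm of the gradient controls the L² norm. Applied to g², whose L² norm
    -- is the square of the L⁴ norm of g, this is the inequality for test functions.
    have h1 := eLpNorm_le_eLpNorm_fderiv_one (volume : Measure Plane)
      (u := fun x => g x * g x) ((hg.mul hg).of_le (by exact_mod_cast le_top)) hgc.mul_left hconj
    have h2 : eLpNorm (fun x => g x * g x) ((2 : NNReal) : ℝ≥0∞) volume =
        eLpNorm g 4 volume ^ 2 := by
      have h3 := eLpNorm_norm_rpow g (p := 2) (μ := (volume : Measure Plane)) (q := 2) two_pos
      have h4 : (2 : ℝ≥0∞) * ENNReal.ofReal 2 = 4 := by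
        rw [ENNReal.ofReal_ofNat]; norm_num
      rw [h4, ENNReal.rpow_two] at h3
      rw [← h3]
      refine eLpNorm_congr_norm_ae (Eventually.of_forall fun x => ?_)
      simp [sq]
    rw [h2] at h1
    refine h1.trans ?_
    rw [mul_assoc]
    gcongr
    exact eLpNorm_fderiv_sq_le hg
  refine ⟨K * 2, ENNReal.mul_ne_top ENNReal.coe_ne_top (by norm_num), fun {f f'} hf => ?_⟩
  obtain ⟨g, hg, hgc, h1, h2⟩ := hf.exists_seq
  have hcv : ∀ {q : Plane → ℂ} {r : ℕ → Plane → ℂ}, MemLp q 2 volume →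
      (∀ n, AEStronglyMeasurable (r n) volume) →
      Tendsto (fun n => eLpNorm (q - r n) 2 volume) atTop (𝓝 0) → ∀ ε, 0 < ε →
      ∀ᶠ n in atTop, eLpNorm (r n) 2 volume ≤ eLpNorm q 2 volume + ε := by
    intro q r hq hr h ε hε
    filter_upwards [ENNReal.tendsto_nhds_zero.1 h ε hε] with n hn
    have e : r n = q - (q - r n) := by abel
    rw [e]
    exact (eLpNorm_sub_le hq.1 (hq.1.sub (hr n)) (by norm_num)).trans (by gcongr)
  -- A subsequence converges almost everywhere, and Fatou's lemma bounds the L⁴ norm of f. The norms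
  -- on the right exceed those of f and f' by at most ε, which is then sent to zero.
  have hmeas : TendstoInMeasure volume g atTop f := by
    refine tendstoInMeasure_of_tendsto_eLpNorm (p := 2) (by norm_num)
      (fun n => (hg n).continuous.aestronglyMeasurable) hf.memLp.1 ?_
    refine h1.congr fun n => ?_
    rw [← eLpNorm_neg, neg_sub]
  obtain ⟨ns, hns, hae⟩ := hmeas.exists_seq_tendsto_ae
  have hlim := Lp.eLpNorm_lim_le_liminf_eLpNorm (p := 4) (f := fun n => g (ns n))
    (fun n => (hg (ns n)).continuous.aestronglyMeasurable) f hae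
  have hε : ∀ ε : ℝ≥0∞, 0 < ε → eLpNorm f 4 volume ^ 2 ≤
      K * 2 * ((eLpNorm f 2 volume + ε) * ∑ i, (eLpNorm (f' i) 2 volume + ε)) := by
    intro ε hε
    have hev : ∀ᶠ n in atTop, eLpNorm (g (ns n)) 4 volume ≤
        (K * 2 * ((eLpNorm f 2 volume + ε) * ∑ i, (eLpNorm (f' i) 2 volume + ε))) ^ (2⁻¹ : ℝ) := by
      have h3 := hns.tendsto_atTop.eventually
        ((hcv hf.memLp (fun n => (hg n).continuous.aestronglyMeasurable) h1 ε hε).and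
        (eventually_all.2 fun i => hcv (hf.memLp' i)
          (fun n => (continuous_partialDeriv (hg n) i).aestronglyMeasurable) (h2 i) ε hε))
      filter_upwards [h3] with n hn
      rw [ENNReal.le_rpow_inv_iff two_pos, ENNReal.rpow_two]
      refine (hsm (hg _) (hgc _)).trans ?_
      gcongr with i
      · exact hn.1
      · exact hn.2 i
    have h4 := hlim.trans (liminf_le_of_le (by isBoundedDefault) fun b hb =>
      (hb.and hev).exists.elim fun n hn => hn.1.trans hn.2)
    rwa [ENNReal.le_rpow_inv_iff two_pos, ENNReal.rpow_two] at h4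
  have hcont : Tendsto (fun ε : ℝ≥0∞ => K * 2 * ((eLpNorm f 2 volume + ε) *
      ∑ i, (eLpNorm (f' i) 2 volume + ε))) (𝓝[>] 0)
      (𝓝 (K * 2 * ((eLpNorm f 2 volume + 0) * ∑ i, (eLpNorm (f' i) 2 volume + 0)))) := by
    have hid : Tendsto (fun ε : ℝ≥0∞ => ε) (𝓝[>] 0) (𝓝 0) := tendsto_id.mono_left nhdsWithin_le_nhds
    have hs : Tendsto (fun ε : ℝ≥0∞ => ∑ i, (eLpNorm (f' i) 2 volume + ε)) (𝓝[>] 0)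
        (𝓝 (∑ i, (eLpNorm (f' i) 2 volume + 0))) :=
      tendsto_finsetSum _ fun i _ => tendsto_const_nhds.add hid
    have hfin : ∑ i, (eLpNorm (f' i) 2 volume + 0) ≠ ∞ := by
      simpa using fun i => (hf.memLp' i).2.ne
    refine ENNReal.Tendsto.const_mul (ENNReal.Tendsto.mul (tendsto_const_nhds.add hid)
      (Or.inr hfin) hs (Or.inr (by simpa using hf.memLp.2.ne))) (Or.inr ?_)
    exact ENNReal.mul_ne_top ENNReal.coe_ne_top (by norm_num)
  have hne : (𝓝[>] (0 : ℝ≥0∞)).NeBot := nhdsGT_neBot_of_exists_gt ⟨1, one_pos⟩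
  simpa using ge_of_tendsto hcont (eventually_nhdsWithin_of_forall hε)

theorem HasGradient.memLp_four {f : Plane → ℂ} {f' : Fin 2 → Plane → ℂ} (hf : HasGradient f f') :
    MemLp f 4 volume := by
  obtain ⟨C, hC, h⟩ := exists_eLpNorm_four_le
  refine ⟨hf.memLp.1, ?_⟩
  have h1 : eLpNorm f 4 volume ^ 2 < ∞ := (h hf).trans_lt (ENNReal.mul_lt_top hC.lt_top
    (ENNReal.mul_lt_top hf.memLp.2 (ENNReal.sum_lt_top.2 fun i _ => (hf.memLp' i).2)))
  exact lt_of_not_ge fun h2 => by simp [top_le_iff.1 h2] at h1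

/-! ### The weak form of the equation -/

theorem tendsto_integral_mul_of_L2 {ι : Type*} {l : Filter ι} {f k : Plane → ℂ}
    {F : ι → Plane → ℂ} (hf : MemLp f 2 volume) (hF : ∀ n, MemLp (F n) 2 volume)
    (hk : MemLp k 2 volume) (h : Tendsto (fun n => eLpNorm (f - F n) 2 volume) l (𝓝 0)) :
    Tendsto (fun n => ∫ x, F n x * k x) l (𝓝 (∫ x, f x * k x)) := by
  refine tendsto_integral_of_L1' _ (hf.integrable_mul hk).1
    (Eventually.of_forall fun n => (hF n).integrable_mul hk) ?_
  have h2 := ENNReal.Tendsto.mul_const h (b := eLpNorm k 2 volume) (Or.inr hk.2.ne)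
  rw [zero_mul] at h2
  refine tendsto_of_tendsto_of_tendsto_of_le_of_le tendsto_const_nhds h2 (fun _ => zero_le)
    fun n => ?_
  refine (eLpNorm_le_mul_mul (p := 2) (q := 2) (C := 1) (hf.1.sub (hF n).1) hk.1
    (Eventually.of_forall fun x => ?_)).trans (by simp)
  rw [Pi.sub_apply, Pi.mul_apply, ← sub_mul, norm_mul, Pi.sub_apply,
    norm_sub_rev, one_mul]

theorem HasGradient.integral_mul_partialDeriv {f : Plane → ℂ} {f' : Fin 2 → Plane → ℂ}
    (hf : HasGradient f f') {χ : Plane → ℂ} (hχ : ContDiff ℝ ((⊤ : ℕ∞) : WithTop ℕ∞) χ)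
    (hχc : HasCompactSupport χ) (i : Fin 2) :
    ∫ x, f x * partialDeriv i χ x = - ∫ x, f' i x * χ x := by
  obtain ⟨g, hg, hgc, h1, h2⟩ := hf.exists_seq
  have hgg := fun n => hasGradient_of_contDiff (hg n) (hgc n)
  have hχχ := hasGradient_of_contDiff hχ hχc
  have l1 := tendsto_integral_mul_of_L2 hf.memLp (fun n => (hgg n).memLp) (hχχ.memLp' i) h1
  have l2 := (tendsto_integral_mul_of_L2 (hf.memLp' i) (fun n => (hgg n).memLp' i)
    hχχ.memLp (h2 i)).neg
  refine tendsto_nhds_unique l1 (l2.congr fun n => ?_)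
  rw [eq_comm]
  exact integral_mul_fderiv_eq_neg_fderiv_mul_of_integrable
    (((hgg n).memLp' i).integrable_mul hχχ.memLp)
    ((hgg n).memLp.integrable_mul (hχχ.memLp' i))
    ((hgg n).memLp.integrable_mul hχχ.memLp)
    (fun x _ => (hg n).differentiable (by simp) x) (fun x _ => hχ.differentiable (by simp) x)

theorem laplacian_eq_sum_partialDeriv {χ : Plane → ℂ}
    (hχ : ContDiff ℝ ((⊤ : ℕ∞) : WithTop ℕ∞) χ) (x : Plane) :
    Laplacian.laplacian χ x = ∑ i, partialDeriv i (partialDeriv i χ) x := by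
  rw [InnerProductSpace.laplacian_eq_iteratedFDeriv_orthonormalBasis χ
    (EuclideanSpace.basisFun (Fin 2) ℝ)]
  refine Finset.sum_congr rfl fun i _ => ?_
  have hd : DifferentiableAt ℝ (fderiv ℝ χ) x :=
    (hχ.fderiv_right (m := ((⊤ : ℕ∞) : WithTop ℕ∞)) (by simp)).differentiable (by simp) x
  have h1 : HasFDerivAt (partialDeriv i χ) _ x :=
    hd.hasFDerivAt.clm_apply (hasFDerivAt_const (basisVec i) x)
  rw [iteratedFDeriv_two_apply]
  conv_rhs => rw [partialDeriv, h1.fderiv]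
  simp [basisVec]

theorem HasGradient.integral_mul_laplacian {f : Plane → ℂ} {f' : Fin 2 → Plane → ℂ}
    (hf : HasGradient f f') {χ : Plane → ℂ} (hχ : ContDiff ℝ ((⊤ : ℕ∞) : WithTop ℕ∞) χ)
    (hχc : HasCompactSupport χ) :
    ∫ x, f x * Laplacian.laplacian χ x = - ∑ i, ∫ x, f' i x * partialDeriv i χ x := by
  have hi : ∀ i, Integrable fun x => f x * partialDeriv i (partialDeriv i χ) x := fun i =>
    hf.memLp.integrable_mul ((hasGradient_of_contDiff (contDiff_partialDeriv hχ i)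
      (hasCompactSupport_partialDeriv hχc i)).memLp' i)
  calc ∫ x, f x * Laplacian.laplacian χ x
      = ∫ x, ∑ i, f x * partialDeriv i (partialDeriv i χ) x := by
        simp_rw [laplacian_eq_sum_partialDeriv hχ, Finset.mul_sum]
    _ = ∑ i, ∫ x, f x * partialDeriv i (partialDeriv i χ) x :=
        integral_finsetSum _ fun i _ => hi i
    _ = _ := by
        rw [← Finset.sum_neg_distrib]
        exact Finset.sum_congr rfl fun i _ => hf.integral_mul_partialDeriv
          (contDiff_partialDeriv hχ i) (hasCompactSupport_partialDeriv hχc i) i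

/-- A bound for the pairing with a potential in `L^∞ + L²`. -/
theorem eLpNorm_potential_mul_le {V β : Plane → ℝ}
    (hβ : MemLp β 2 volume) (hVβ : ∀ᵐ x, |V x| ≤ 1 + |β x|) {u w : Plane → ℂ}
    (hu : AEStronglyMeasurable u volume) (hw : AEStronglyMeasurable w volume) :
    eLpNorm (fun x => (V x : ℂ) * u x * w x) 1 volume ≤
      eLpNorm u 2 volume * eLpNorm w 2 volume +
        eLpNorm β 2 volume * (eLpNorm u 4 volume * eLpNorm w 4 volume) := by
  have h1 : eLpNorm (fun x => u x * w x) 1 volume ≤ eLpNorm u 2 volume * eLpNorm w 2 volume := by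
    refine (eLpNorm_le_mul_mul (p := 2) (q := 2) (C := 1) hu hw
      (Eventually.of_forall fun x => ?_)).trans (by simp)
    rw [norm_mul, one_mul]
  have h2 : eLpNorm (fun x => u x * w x) 2 volume ≤ eLpNorm u 4 volume * eLpNorm w 4 volume := by
    refine (eLpNorm_le_mul_mul (p := 4) (q := 4) (C := 1) hu hw
      (Eventually.of_forall fun x => ?_)).trans (by simp)
    rw [norm_mul, one_mul]
  have h3 : eLpNorm (fun x => β x • (u x * w x)) 1 volume ≤
      eLpNorm β 2 volume * (eLpNorm u 4 volume * eLpNorm w 4 volume) := by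
    refine ((eLpNorm_le_mul_mul (p := 2) (q := 2) (C := 1) hβ.1 (hu.mul hw)
      (Eventually.of_forall fun x => ?_)).trans ?_)
    · rw [norm_smul, one_mul, Pi.mul_apply]
    · rw [ENNReal.ofReal_one, one_mul]
      gcongr
      exact h2
  have h4 : eLpNorm (fun x => (V x : ℂ) * u x * w x) 1 volume ≤
      eLpNorm ((fun x => ‖u x * w x‖) + fun x => ‖β x • (u x * w x)‖) 1 volume := by
    refine eLpNorm_mono_ae_real ?_
    filter_upwards [hVβ] with x hx
    rw [mul_assoc, norm_mul, Complex.norm_real, Pi.add_apply, norm_smul, Real.norm_eq_abs,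
      Real.norm_eq_abs]
    nlinarith [norm_nonneg (u x * w x)]
  refine h4.trans ((eLpNorm_add_le (hu.mul hw).norm (hβ.1.smul (hu.mul hw)).norm le_rfl).trans ?_)
  rw [eLpNorm_norm, eLpNorm_norm]
  exact add_le_add h1 h3

theorem integrable_potential_mul {V β : Plane → ℝ} (hV : AEStronglyMeasurable V volume)
    (hβ : MemLp β 2 volume) (hVβ : ∀ᵐ x, |V x| ≤ 1 + |β x|) {u w : Plane → ℂ}
    (hu : MemLp u 2 volume) (hw : MemLp w 2 volume)
    (hu4 : MemLp u 4 volume) (hw4 : MemLp w 4 volume) :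
    Integrable (fun x => (V x : ℂ) * u x * w x) volume := by
  rw [← memLp_one_iff_integrable]
  refine ⟨((Complex.continuous_ofReal.comp_aestronglyMeasurable hV).mul hu.1).mul hw.1, ?_⟩
  refine (eLpNorm_potential_mul_le hβ hVβ hu.1 hw.1).trans_lt (ENNReal.add_lt_top.2
    ⟨ENNReal.mul_lt_top hu.2 hw.2, ENNReal.mul_lt_top hβ.2 (ENNReal.mul_lt_top hu4.2 hw4.2)⟩)

/-- Approximants converging in L² along with their gradients also converge in L⁴ by Ladyzhenskaya,
and the pairing with a potential in L^∞ + L² is controlled by these two norms. -/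
theorem tendsto_integral_potential_mul {V β : Plane → ℝ} (hV : AEStronglyMeasurable V volume)
    (hβ : MemLp β 2 volume) (hVβ : ∀ᵐ x, |V x| ≤ 1 + |β x|) {u w : Plane → ℂ}
    {w' u' : Fin 2 → Plane → ℂ} (hu : HasGradient u u') (hw : HasGradient w w')
    {g : ℕ → Plane → ℂ} (hg : ∀ n, ContDiff ℝ ((⊤ : ℕ∞) : WithTop ℕ∞) (g n))
    (hgc : ∀ n, HasCompactSupport (g n))
    (h : Tendsto (fun n => eLpNorm (w - g n) 2 volume) atTop (𝓝 0))
    (h' : ∀ i, Tendsto (fun n => eLpNorm (w' i - partialDeriv i (g n)) 2 volume) atTop (𝓝 0)) :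
    Tendsto (fun n => ∫ x, (V x : ℂ) * u x * g n x) atTop (𝓝 (∫ x, (V x : ℂ) * u x * w x)) := by
  have hgg := fun n => hasGradient_of_contDiff (hg n) (hgc n)
  have hI : ∀ {q : Plane → ℂ} {q' : Fin 2 → Plane → ℂ}, HasGradient q q' →
      Integrable (fun x => (V x : ℂ) * u x * q x) volume := fun hq =>
    integrable_potential_mul hV hβ hVβ hu.memLp hq.memLp hu.memLp_four hq.memLp_four
  refine tendsto_integral_of_L1' _ (hI hw).1 (Eventually.of_forall fun n => hI (hgg n)) ?_
  obtain ⟨C, hC, hC4⟩ := exists_eLpNorm_four_le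
  have h4 : Tendsto (fun n => eLpNorm (w - g n) 4 volume) atTop (𝓝 0) := by
    have hs : Tendsto (fun n => ∑ i, eLpNorm (w' i - partialDeriv i (g n)) 2 volume) atTop
        (𝓝 (∑ _ : Fin 2, 0)) := tendsto_finsetSum _ fun i _ => h' i
    have h5 : Tendsto (fun n => (C * (eLpNorm (w - g n) 2 volume *
        ∑ i, eLpNorm (w' i - partialDeriv i (g n)) 2 volume)) ^ (2⁻¹ : ℝ)) atTop (𝓝 0) := by
      have h6 := ENNReal.Tendsto.const_mul (a := C) (ENNReal.Tendsto.mul h (Or.inr (by simp)) hs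
        (Or.inr (by simp))) (Or.inr hC)
      have h7 := (ENNReal.continuous_rpow_const (y := (2⁻¹ : ℝ))).continuousAt.tendsto.comp h6
      simpa [Function.comp_def] using h7
    refine tendsto_of_tendsto_of_tendsto_of_le_of_le tendsto_const_nhds h5 (fun _ => zero_le)
      fun n => ?_
    rw [ENNReal.le_rpow_inv_iff two_pos, ENNReal.rpow_two]
    exact hC4 (hw.sub (hgg n))
  have l1 := ENNReal.Tendsto.const_mul (a := eLpNorm u 2 volume) h (Or.inr hu.memLp.2.ne)
  have l2 := ENNReal.Tendsto.const_mul (a := eLpNorm β 2 volume)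
    (ENNReal.Tendsto.const_mul (a := eLpNorm u 4 volume) h4 (Or.inr hu.memLp_four.2.ne))
    (Or.inr hβ.2.ne)
  have l3 := l1.add l2
  simp only [mul_zero, add_zero] at l3
  refine tendsto_of_tendsto_of_tendsto_of_le_of_le tendsto_const_nhds l3 (fun _ => zero_le)
    fun n => ?_
  refine le_trans (le_of_eq ?_) (eLpNorm_potential_mul_le hβ hVβ hu.memLp.1
    (hw.memLp.1.sub (hgg n).memLp.1))
  refine eLpNorm_congr_norm_ae (Eventually.of_forall fun x => ?_)
  simp only [Pi.sub_apply]
  rw [← mul_sub, norm_mul, norm_sub_rev, ← norm_mul]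

/-! ### The potential `E₁(|u|²)` and the extension of the equation to `H¹` test functions -/

theorem memLp_ofReal_norm_sq {u : Plane → ℂ} (hu : MemLp u 4 volume) :
    MemLp (fun y => ((‖u y‖ ^ 2 : ℝ) : ℂ)) 2 volume := by
  refine ⟨?_, ?_⟩
  · exact Complex.continuous_ofReal.comp_aestronglyMeasurable (hu.1.norm.pow 2)
  · refine (eLpNorm_le_mul_mul (p := 4) (q := 4) (C := 1) hu.1 hu.1
      (Eventually.of_forall fun x => ?_)).trans_lt ?_
    · simp [sq]
    · rw [ENNReal.ofReal_one, one_mul]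
      exact ENNReal.mul_lt_top hu.2 hu.2

/-- The real-valued potential `E₁(|u|²)`. -/
def potential (u : Plane → ℂ) (x : Plane) : ℝ := (E₁ (fun y => ((‖u y‖ ^ 2 : ℝ) : ℂ)) x).re

theorem E₁_norm_sq {u : Plane → ℂ} (hu : MemLp u 4 volume) :
    E₁ (fun y => ((‖u y‖ ^ 2 : ℝ) : ℂ)) = E₁L2 ((memLp_ofReal_norm_sq hu).toLp _) := by
  rw [E₁, dif_pos (memLp_ofReal_norm_sq hu)]

theorem coe_potential {u : Plane → ℂ} (hu : MemLp u 4 volume) :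
    E₁L2 ((memLp_ofReal_norm_sq hu).toLp _) =ᵐ[volume] fun x => (potential u x : ℂ) := by
  have h1 : (memLp_ofReal_norm_sq hu).toLp _ =ᵐ[volume]
      fun x => conj ((memLp_ofReal_norm_sq hu).toLp _ x) := by
    filter_upwards [(memLp_ofReal_norm_sq hu).coeFn_toLp] with x hx
    rw [hx, Complex.conj_ofReal]
  filter_upwards [conj_E₁L2 h1] with x hx
  rw [potential, E₁_norm_sq hu]
  exact (Complex.conj_eq_iff_re.1 hx.symm).symm

theorem memLp_potential {u : Plane → ℂ} (hu : MemLp u 4 volume) :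
    MemLp (potential u) 2 volume := by
  refine (memLp_congr_ae ?_).1 (Lp.memLp (E₁L2 ((memLp_ofReal_norm_sq hu).toLp _))).re
  filter_upwards [coe_potential hu] with x hx
  rw [hx]
  simp

/-- Places |u|^{p-1} in L^∞ + L², with |u|² as the L² part. This is where the upper bound on p
enters. -/
theorem rpow_le_one_add_sq {p r : ℝ} (hp₁ : 1 < p) (hp₃ : p < 3) (hr : 0 ≤ r) :
    r ^ (p - 1) ≤ 1 + r ^ 2 := by
  rcases le_total r 1 with h | h
  · have := Real.rpow_le_one hr h (by linarith : 0 ≤ p - 1)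
    nlinarith [sq_nonneg r]
  · have h1 := Real.rpow_le_rpow_of_exponent_le h (by linarith : p - 1 ≤ 2)
    rw [Real.rpow_two] at h1
    linarith

/-- The equation holds for test functions in `H¹`. -/
theorem IsSolution.weak_form {p ω : ℝ} (hp₁ : 1 < p) (hp₃ : p < 3) {u : L2}
    (h : IsSolution p ω u) {v : Fin 2 → Plane → ℂ} (hv : HasGradient u v)
    {w : Plane → ℂ} {w' : Fin 2 → Plane → ℂ} (hw : HasGradient w w') :
    -(∑ i, ∫ x, v i x * w' i x) - ω * (∫ x, u x * w x)
      + (∫ x, ((‖u x‖ ^ (p - 1) : ℝ) : ℂ) * u x * w x)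
      + (∫ x, (potential u x : ℂ) * u x * w x) = 0 := by
  have hu4 := hv.memLp_four
  obtain ⟨g, hg, hgc, h1, h2⟩ := hw.exists_seq
  have hgg := fun n => hasGradient_of_contDiff (hg n) (hgc n)
  have e : ∀ n, -(∑ i, ∫ x, v i x * partialDeriv i (g n) x) - ω * (∫ x, u x * g n x)
      + (∫ x, ((‖u x‖ ^ (p - 1) : ℝ) : ℂ) * u x * g n x)
      + (∫ x, (potential u x : ℂ) * u x * g n x) = 0 := fun n => by
    rw [← h.equation (g n) (hg n) (hgc n), hv.integral_mul_laplacian (hg n) (hgc n),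
      E₁_norm_sq hu4]
    congr 1
    refine integral_congr_ae ?_
    filter_upwards [coe_potential hu4] with x hx
    rw [hx]
  have t1 : Tendsto (fun n => ∑ i, ∫ x, v i x * partialDeriv i (g n) x) atTop
      (𝓝 (∑ i, ∫ x, v i x * w' i x)) := by
    refine tendsto_finsetSum _ fun i _ => ?_
    simp_rw [mul_comm (v i _)]
    exact tendsto_integral_mul_of_L2 (hw.memLp' i) (fun n => (hgg n).memLp' i) (hv.memLp' i) (h2 i)
  have t2 : Tendsto (fun n => ∫ x, u x * g n x) atTop (𝓝 (∫ x, u x * w x)) := by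
    simp_rw [mul_comm (u _)]
    exact tendsto_integral_mul_of_L2 hw.memLp (fun n => (hgg n).memLp) hv.memLp h1
  have hu2 : MemLp (fun x => ‖u x‖ ^ 2) 2 volume := by
    refine (memLp_ofReal_norm_sq hu4).of_le (hv.memLp.1.norm.pow 2)
      (Eventually.of_forall fun x => by simp)
  have hpm : AEStronglyMeasurable (fun x => ‖u x‖ ^ (p - 1)) volume :=
    (Real.continuous_rpow_const (by linarith)).comp_aestronglyMeasurable hv.memLp.1.norm
  -- Both nonlinear terms are linear in u once the potential is frozen: the L² majorant is |u|² for
  -- the power and the potential itself for the nonlocal term.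
  have t3 := tendsto_integral_potential_mul (V := fun x => ‖u x‖ ^ (p - 1)) hpm hu2
    (Eventually.of_forall fun x => by
      rw [abs_of_nonneg (by positivity), abs_of_nonneg (by positivity)]
      exact rpow_le_one_add_sq hp₁ hp₃ (norm_nonneg _)) hv hw hg hgc h1 h2
  have t4 := tendsto_integral_potential_mul (V := potential u) (memLp_potential hu4).1
    (memLp_potential hu4) (Eventually.of_forall fun x => by linarith) hv hw hg hgc h1 h2
  have t := ((t1.neg.sub (t2.const_mul (ω : ℂ))).add t3).add t4
  exact tendsto_nhds_unique t (tendsto_const_nhds.congr fun n => (e n).symm)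

/-! ### Translations in `L²` -/

theorem tendsto_translate (f : L2) : Tendsto (fun h : Plane => translate h f) (𝓝 0) (𝓝 f) := by
  let g : C(Plane, C(Plane, Plane)) :=
    (ContinuousMap.mk (fun a : Plane × Plane => a.2 + a.1) (by fun_prop)).curry
  have h := Tendsto.compMeasurePreservingLp (p := 2) (l := 𝓝 (0 : Plane)) (f := fun _ => f) (f₀ := f)
    (g := fun h => g h) (g₀ := g 0) tendsto_const_nhds (g.continuous.tendsto 0)
    (fun h => measurePreserving_add_const h) (measurePreserving_add_const 0) (by norm_num)
  have e : translate 0 f = f := by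
    refine Lp.ext ?_
    filter_upwards [coeFn_translate 0 f] with x hx
    rw [hx, add_zero]
  have h' : Tendsto (fun h : Plane => translate h f) (𝓝 0) (𝓝 (translate 0 f)) := h
  rwa [e] at h'

theorem tendsto_smul_basisVec (j : Fin 2) :
    Tendsto (fun h : ℝ => h • basisVec j) (𝓝[≠] 0) (𝓝 0) := by
  have : Continuous fun h : ℝ => h • basisVec j := by fun_prop
  simpa using (this.tendsto 0).mono_left nhdsWithin_le_nhds

theorem eLpNorm_coe_sub (f g : L2) :
    eLpNorm (fun x => f x - g x) 2 volume = ENNReal.ofReal ‖f - g‖ := by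
  rw [Lp.norm_def, ENNReal.ofReal_toReal (Lp.eLpNorm_ne_top _)]
  exact eLpNorm_congr_ae (Lp.coeFn_sub f g).symm

theorem eLpNorm_translate_sub (f : L2) (h : Plane) :
    eLpNorm (fun x => f (x + h) - f x) 2 volume = ENNReal.ofReal ‖translate h f - f‖ := by
  rw [← eLpNorm_coe_sub]
  refine eLpNorm_congr_ae ?_
  filter_upwards [coeFn_translate h f] with x hx
  rw [hx]

theorem tendsto_eLpNorm_translate_sub (f : L2) (j : Fin 2) :
    Tendsto (fun h : ℝ => eLpNorm (fun x => f (x + h • basisVec j) - f x) 2 volume)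
      (𝓝[≠] 0) (𝓝 0) := by
  simp_rw [eLpNorm_translate_sub]
  have h := ((tendsto_translate f).comp (tendsto_smul_basisVec j)).sub_const f
  rw [sub_self] at h
  simpa using ENNReal.tendsto_ofReal h.norm

theorem wave_smul_basisVec (h : ℝ) (j : Fin 2) (ξ : Plane) :
    wave (h • basisVec j) ξ = Complex.exp ((2 * π * (h * ξ j) : ℝ) * Complex.I) := by
  rw [wave, real_inner_smul_left, inner_basisVec']

/-- Plancherel and |e^{iθ} - 1| ≤ |θ|. It supplies the factor h that cancels the division by h in
the quadratic remainders. -/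
theorem norm_translate_sub_le {u w : L2} {j : Fin 2}
    (hw : (𝓕 w : L2) =ᵐ[volume] fun ξ => (2 * π * Complex.I * (ξ j : ℂ)) * (𝓕 u : L2) ξ) (h : ℝ) :
    ‖translate (h • basisVec j) u - u‖ ≤ |h| * ‖w‖ := by
  rw [← Lp.norm_fourier_eq, ← Lp.norm_fourier_eq w]
  refine Lp.norm_le_mul_norm_of_ae_le_mul ?_
  rw [fourier_sub']
  filter_upwards [hw, fourier_translate (h • basisVec j) u,
    Lp.coeFn_sub (𝓕 (translate (h • basisVec j) u) : L2) (𝓕 u)] with ξ h1 h2 h3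
  rw [h3, Pi.sub_apply, h2, h1, ← sub_one_mul, norm_mul, norm_mul, ← mul_assoc, wave_smul_basisVec]
  gcongr
  rw [mul_comm _ Complex.I]
  refine (Real.norm_exp_I_mul_ofReal_sub_one_le).trans (le_of_eq ?_)
  simp [abs_of_pos pi_pos]
  ring

/-- With θ = 2πhξ_j, e^{iθ} - e^{-iθ} = 2i sin θ = 2iθ sinc θ. The factor 2πi ξ_j goes into 𝓕w, and
the remaining multiplier is bounded even though ξ_j is not. -/
theorem fourier_centralDifference {u w : L2} {j : Fin 2}
    (hw : (𝓕 w : L2) =ᵐ[volume] fun ξ => (2 * π * Complex.I * (ξ j : ℂ)) * (𝓕 u : L2) ξ)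
    (h : ℝ) :
    (𝓕 (translate (h • basisVec j) u - translate ((-h) • basisVec j) u) : L2) =ᵐ[volume]
      fun ξ => ((2 * h * sinc (2 * π * (h * ξ j)) : ℝ) : ℂ) * (𝓕 w : L2) ξ := by
  rw [fourier_sub']
  filter_upwards [hw, fourier_translate (h • basisVec j) u, fourier_translate ((-h) • basisVec j) u,
    Lp.coeFn_sub (𝓕 (translate (h • basisVec j) u) : L2)
      (𝓕 (translate ((-h) • basisVec j) u))] with ξ h1 h2 h3 h4
  rw [h4, Pi.sub_apply, h2, h3, h1, ← sub_mul, ← mul_assoc]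
  congr 1
  rw [wave_smul_basisVec, wave_smul_basisVec]
  have e1 : (2 * π * (-h * ξ j) : ℝ) = -(2 * π * (h * ξ j)) := by ring
  rw [e1]
  set θ := 2 * π * (h * ξ j) with hθ
  have e2 : sin θ = θ * sinc θ := by
    rcases eq_or_ne θ 0 with h0 | h0
    · simp [h0]
    · rw [sinc_of_ne_zero h0, mul_div_cancel₀ _ h0]
  have e3 : Complex.exp ((θ : ℝ) * Complex.I) - Complex.exp ((-θ : ℝ) * Complex.I) =
      2 * Complex.I * (sin θ : ℝ) := by
    rw [Complex.exp_mul_I, Complex.exp_mul_I]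
    push_cast
    rw [Complex.cos_neg, Complex.sin_neg]
    ring
  rw [e3, e2, hθ]
  push_cast
  ring

/-- Dominated convergence for a bounded factor and a factor that converges in `L¹`. -/
theorem tendsto_integral_mul_of_L1 {ι : Type*} {l : Filter ι} [l.IsCountablyGenerated]
    {q : ι → Plane → ℝ} {q₀ : Plane → ℝ} {F : ι → Plane → ℝ} {f : Plane → ℝ} {K : ℝ}
    (hq : ∀ i, AEStronglyMeasurable (q i) volume) (hK : ∀ i x, |q i x| ≤ K)
    (hlim : ∀ᵐ x, Tendsto (fun i => q i x) l (𝓝 (q₀ x))) (hf : Integrable f volume)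
    (hF : ∀ i, Integrable (F i) volume)
    (h : Tendsto (fun i => eLpNorm (fun x => F i x - f x) 1 volume) l (𝓝 0)) :
    Tendsto (fun i => ∫ x, q i x * F i x) l (𝓝 (∫ x, q₀ x * f x)) := by
  have hb : ∀ i, ∀ {k : Plane → ℝ}, Integrable k volume → Integrable (fun x => q i x * k x) volume :=
    fun i k hk => hk.bdd_mul (hq i) (Eventually.of_forall fun x => hK i x)
  have h1 : Tendsto (fun i => ∫ x, q i x * f x) l (𝓝 (∫ x, q₀ x * f x)) := by
    refine tendsto_integral_filter_of_dominated_convergence (fun x => K * |f x|)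
      (Eventually.of_forall fun i => (hb i hf).1) (Eventually.of_forall fun i =>
        Eventually.of_forall fun x => ?_) (hf.abs.const_mul K) ?_
    · rw [norm_mul]
      exact mul_le_mul_of_nonneg_right (hK i x) (abs_nonneg _)
    · filter_upwards [hlim] with x hx
      exact hx.mul_const _
  have h2 : Tendsto (fun i => ∫ x, q i x * (F i x - f x)) l (𝓝 (∫ _ : Plane, (0 : ℝ))) := by
    refine tendsto_integral_of_L1' _ aestronglyMeasurable_const
      (Eventually.of_forall fun i => hb i ((hF i).sub hf)) ?_
    have h3 := ENNReal.Tendsto.const_mul (a := ENNReal.ofReal K) h (Or.inr ENNReal.ofReal_ne_top)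
    rw [mul_zero] at h3
    refine tendsto_of_tendsto_of_tendsto_of_le_of_le tendsto_const_nhds h3 (fun _ => zero_le)
      fun i => ?_
    refine eLpNorm_le_mul_eLpNorm_of_ae_le_mul (Eventually.of_forall fun x => ?_) 1
    simp only [Pi.sub_apply, sub_zero]
    rw [norm_mul]
    gcongr
    exact hK i x
  have h3 := h2.add h1
  rw [integral_zero, zero_add] at h3
  refine h3.congr fun i => ?_
  have hs : Integrable (fun x => q i x * (F i x - f x)) volume := hb i ((hF i).sub hf)
  rw [← integral_add hs (hb i hf)]
  refine integral_congr_ae (Eventually.of_forall fun x => ?_)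
  ring

theorem integrable_re_mul_conj {f g : Plane → ℂ} (hf : MemLp f 2 volume) (hg : MemLp g 2 volume) :
    Integrable (fun x => (f x * conj (g x)).re) volume :=
  (hf.integrable_mul hg.star).re

theorem re_inner_eq_integral (f g : L2) :
    (inner ℂ g f).re = ∫ x, (f x * conj (g x)).re := by
  rw [L2.inner_def, ← RCLike.re_eq_complex_re, ← integral_re (L2.integrable_inner g f)]
  refine integral_congr_ae (Eventually.of_forall fun x => ?_)
  simp [RCLike.inner_apply]

theorem integral_re_mul_conj_fourier (f g : L2) :
    ∫ x, ((𝓕 f : L2) x * conj ((𝓕 g : L2) x)).re = ∫ x, (f x * conj (g x)).re := by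
  rw [← re_inner_eq_integral, ← re_inner_eq_integral, Lp.inner_fourier_eq]

/-- Central differences converge weakly to the derivative. -/
theorem tendsto_integral_centralDifference {u w k : L2} {j : Fin 2}
    (hw : (𝓕 w : L2) =ᵐ[volume] fun ξ => (2 * π * Complex.I * (ξ j : ℂ)) * (𝓕 u : L2) ξ) :
    Tendsto (fun h : ℝ => (2 * h)⁻¹ * ∫ x, (k x *
        conj (u (x + h • basisVec j) - u (x + (-h) • basisVec j))).re) (𝓝[≠] 0)
      (𝓝 (∫ x, (k x * conj (w x)).re)) := by
  -- On the Fourier side the difference quotient is 𝓕w times sinc(2πhξ_j), which is bounded by one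
  -- and tends to one.
  have h0 := tendsto_integral_mul_of_L1 (l := 𝓝[≠] (0 : ℝ))
    (q := fun h ξ => sinc (2 * π * (h * ξ j))) (q₀ := fun _ => 1)
    (F := fun _ ξ => ((𝓕 k : L2) ξ * conj ((𝓕 w : L2) ξ)).re)
    (f := fun ξ => ((𝓕 k : L2) ξ * conj ((𝓕 w : L2) ξ)).re) (K := 1)
    (fun h => by
      have : Continuous fun ξ : Plane => sinc (2 * π * (h * ξ j)) := by
        refine continuous_sinc.comp ?_
        fun_prop
      exact this.aestronglyMeasurable)
    (fun h ξ => abs_sinc_le_one _)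
    (Eventually.of_forall fun ξ => by
      have : Continuous fun h : ℝ => sinc (2 * π * (h * ξ j)) := by
        refine continuous_sinc.comp ?_
        fun_prop
      simpa using (this.tendsto 0).mono_left nhdsWithin_le_nhds)
    (integrable_re_mul_conj (Lp.memLp _) (Lp.memLp _))
    (fun _ => integrable_re_mul_conj (Lp.memLp _) (Lp.memLp _)) (by simp)
  simp only [one_mul] at h0
  rw [integral_re_mul_conj_fourier] at h0
  refine h0.congr' ?_
  filter_upwards [self_mem_nhdsWithin] with h hh
  have hh' : h ≠ 0 := hh
  have e1 : ∫ x, (k x * conj (u (x + h • basisVec j) - u (x + (-h) • basisVec j))).re =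
      ∫ x, (k x * conj ((translate (h • basisVec j) u - translate ((-h) • basisVec j) u : L2) x)).re := by
    refine integral_congr_ae ?_
    filter_upwards [Lp.coeFn_sub (translate (h • basisVec j) u) (translate ((-h) • basisVec j) u),
      coeFn_translate (h • basisVec j) u, coeFn_translate ((-h) • basisVec j) u] with x h1 h2 h3
    rw [h1, Pi.sub_apply, h2, h3]
  rw [e1, ← integral_re_mul_conj_fourier, ← integral_const_mul]
  refine integral_congr_ae ?_
  filter_upwards [fourier_centralDifference hw h] with ξ hξ
  rw [hξ, map_mul, Complex.conj_ofReal, mul_left_comm ((𝓕 k : L2) ξ), Complex.re_ofReal_mul]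
  field_simp

/-! ### Weights -/

theorem tendsto_neg_nhdsNE_zero : Tendsto (fun h : ℝ => -h) (𝓝[≠] 0) (𝓝[≠] 0) := by
  refine tendsto_nhdsWithin_iff.2 ⟨?_, ?_⟩
  · simpa using (continuous_neg.tendsto (0 : ℝ)).mono_left nhdsWithin_le_nhds
  · filter_upwards [self_mem_nhdsWithin] with h hh
    simpa using hh

/-- A smooth bounded function `φ` that depends on the `j`-th coordinate only, with derivative `c`
bounded by one. -/
structure IsWeight (j : Fin 2) (φ c : Plane → ℝ) : Prop where
  contDiff : ContDiff ℝ ((⊤ : ℕ∞) : WithTop ℕ∞) φ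
  bounded : ∃ M, ∀ x, |φ x| ≤ M
  fderiv_eq : ∀ i x, fderiv ℝ φ x (basisVec i) = if i = j then c x else 0
  deriv_le : ∀ x, |c x| ≤ 1

theorem IsWeight.hasDerivAt {j : Fin 2} {φ c : Plane → ℝ} (hφ : IsWeight j φ c) (x : Plane) (s : ℝ) :
    HasDerivAt (fun s : ℝ => φ (x + s • basisVec j)) (c (x + s • basisVec j)) s := by
  have h1 : HasDerivAt (fun s : ℝ => x + s • basisVec j) (basisVec j) s := by
    simpa using ((hasDerivAt_id s).smul_const (basisVec j)).const_add x
  have h2 := (hφ.contDiff.differentiable (by simp) (x + s • basisVec j)).hasFDerivAt.comp_hasDerivAt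
    s h1
  rwa [hφ.fderiv_eq, if_pos rfl] at h2

theorem IsWeight.abs_sub_le {j : Fin 2} {φ c : Plane → ℝ} (hφ : IsWeight j φ c) (x : Plane)
    (s t : ℝ) : |φ (x + s • basisVec j) - φ (x + t • basisVec j)| ≤ |s - t| := by
  have := Convex.norm_image_sub_le_of_norm_hasDerivWithin_le (C := 1)
    (fun r _ => (hφ.hasDerivAt x r).hasDerivWithinAt) (fun r _ => hφ.deriv_le _)
    convex_univ (Set.mem_univ t) (Set.mem_univ s)
  simpa using this

theorem IsWeight.tendsto_slope {j : Fin 2} {φ c : Plane → ℝ} (hφ : IsWeight j φ c) (x : Plane) :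
    Tendsto (fun h : ℝ => h⁻¹ * (φ (x + h • basisVec j) - φ x)) (𝓝[≠] 0) (𝓝 (c x)) := by
  have h := (hφ.hasDerivAt x 0).tendsto_slope_zero
  simpa using h

theorem IsWeight.tendsto_symm_slope {j : Fin 2} {φ c : Plane → ℝ} (hφ : IsWeight j φ c)
    (x : Plane) :
    Tendsto (fun h : ℝ => (2 * h)⁻¹ * (φ (x + h • basisVec j) - φ (x + (-h) • basisVec j)))
      (𝓝[≠] 0) (𝓝 (c x)) := by
  have h := ((hφ.tendsto_slope x).add ((hφ.tendsto_slope x).comp tendsto_neg_nhdsNE_zero)).const_mul (1 / 2)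
  have e : (1 / 2 : ℝ) * (c x + c x) = c x := by ring
  rw [e] at h
  refine h.congr' ?_
  filter_upwards [self_mem_nhdsWithin] with h hh
  have hh' : h ≠ 0 := hh
  simp only [Function.comp_apply]
  field_simp
  ring

/-- The quadratic terms in the limit of vanishing increment. -/
theorem IsWeight.tendsto_quadratic {j : Fin 2} {φ c : Plane → ℝ} (hφ : IsWeight j φ c) (v : L2) :
    Tendsto (fun h : ℝ => (2 * h)⁻¹ * ∫ x, φ x * (v x *
        conj (v (x + h • basisVec j) - v (x + (-h) • basisVec j))).re) (𝓝[≠] 0)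
      (𝓝 (-(1 / 2) * ∫ x, c x * ‖v x‖ ^ 2)) := by
  obtain ⟨M, hM⟩ := hφ.bounded
  have hv := Lp.memLp v
  have hvh := fun h : ℝ => memLp_comp_add hv (h • basisVec j)
  have h0 := tendsto_integral_mul_of_L1 (l := 𝓝[≠] (0 : ℝ))
    (q := fun h x => h⁻¹ * (φ (x + h • basisVec j) - φ x)) (q₀ := c)
    (F := fun h x => (v x * conj (v (x + h • basisVec j))).re)
    (f := fun x => (v x * conj (v x)).re) (K := 1)
    (fun h => by
      have hc := hφ.contDiff.continuous
      have : Continuous fun x => h⁻¹ * (φ (x + h • basisVec j) - φ x) := by fun_prop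
      exact this.aestronglyMeasurable)
    (fun h x => by
      have := hφ.abs_sub_le x h 0
      simp only [zero_smul, add_zero, sub_zero] at this
      rw [abs_mul, abs_inv]
      exact (mul_le_mul_of_nonneg_left this (by positivity)).trans
        (inv_mul_le_one_of_le₀ le_rfl (abs_nonneg h)))
    (Eventually.of_forall hφ.tendsto_slope) (integrable_re_mul_conj hv hv)
    (fun h => integrable_re_mul_conj hv (hvh h)) (by
      have h1 := ENNReal.Tendsto.const_mul (a := eLpNorm v 2 volume)
        (tendsto_eLpNorm_translate_sub v j) (Or.inr hv.2.ne)
      rw [mul_zero] at h1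
      refine tendsto_of_tendsto_of_tendsto_of_le_of_le tendsto_const_nhds h1 (fun _ => zero_le)
        fun h => ?_
      refine (eLpNorm_le_mul_mul (p := 2) (q := 2) (C := 1) hv.1 ((hvh h).1.sub hv.1)
        (Eventually.of_forall fun x => ?_)).trans ?_
      · rw [one_mul, ← Complex.sub_re, ← mul_sub, ← map_sub, Real.norm_eq_abs]
        refine (Complex.abs_re_le_norm _).trans ?_
        rw [norm_mul, RCLike.norm_conj]
        rfl
      · rw [ENNReal.ofReal_one, one_mul]
        rfl)
  have h1 := h0.const_mul (-(1 / 2))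
  have e0 : ∫ x, c x * (v x * conj (v x)).re = ∫ x, c x * ‖v x‖ ^ 2 := by
    refine integral_congr_ae (Eventually.of_forall fun x => ?_)
    simp only [Complex.mul_conj, Complex.normSq_eq_norm_sq]
    norm_cast
  rw [e0] at h1
  refine h1.congr' ?_
  filter_upwards [self_mem_nhdsWithin] with h hh
  have hh' : h ≠ 0 := hh
  have hφm : AEStronglyMeasurable φ volume := hφ.contDiff.continuous.aestronglyMeasurable
  have I1 : Integrable (fun x => φ x * (v x * conj (v (x + h • basisVec j))).re) volume :=
    (integrable_re_mul_conj hv (hvh h)).bdd_mul hφm (Eventually.of_forall hM)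
  have I2 : Integrable (fun x => φ x * (v x * conj (v (x + (-h) • basisVec j))).re) volume :=
    (integrable_re_mul_conj hv (hvh (-h))).bdd_mul hφm (Eventually.of_forall hM)
  -- Translate by h e_j and use the symmetry of Re(a conj b). This discrete integration by parts
  -- moves the difference onto φ, so v need only be in L²; it will be applied to the components of
  -- ∇u.
  have e1 : ∫ x, φ x * (v x * conj (v (x + (-h) • basisVec j))).re =
      ∫ x, φ (x + h • basisVec j) * (v x * conj (v (x + h • basisVec j))).re := by
    rw [← integral_add_right_eq_self _ (h • basisVec j)]
    refine integral_congr_ae (Eventually.of_forall fun x => ?_)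
    simp only [neg_smul, add_neg_cancel_right]
    congr 1
    simp only [Complex.mul_re, Complex.conj_re, Complex.conj_im]
    ring
  have I3 : Integrable (fun x => φ (x + h • basisVec j) *
      (v x * conj (v (x + h • basisVec j))).re) volume :=
    (integrable_re_mul_conj hv (hvh h)).bdd_mul
      (hφ.contDiff.continuous.comp (continuous_id.add continuous_const)).aestronglyMeasurable
      (Eventually.of_forall fun x => hM _)
  have e2 : ∫ x, φ x * (v x * conj (v (x + h • basisVec j) - v (x + (-h) • basisVec j))).re =
      -∫ x, (φ (x + h • basisVec j) - φ x) * (v x * conj (v (x + h • basisVec j))).re := by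
    simp_rw [map_sub, mul_sub, Complex.sub_re, mul_sub, sub_mul]
    rw [integral_sub I1 I2, integral_sub I3 I1, e1]
    ring
  rw [e2]
  simp_rw [mul_assoc]
  rw [integral_const_mul]
  field_simp

/-! ### The power nonlinearity -/

/-- The tangent-line inequality for the convex function t^p at s, from Bernoulli's inequality at r/s
- 1. -/
theorem rpow_sub_rpow_le {p r s : ℝ} (hp : 1 < p) (hr : 0 ≤ r) (hrs : r ≤ s) :
    s ^ p - r ^ p ≤ p * s ^ (p - 1) * (s - r) := by
  rcases (hr.trans hrs).eq_or_lt with h0 | h0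
  · have hr0 : r = 0 := le_antisymm (hrs.trans h0.symm.le) hr
    simp [← h0, hr0]
  · have h1 := one_add_mul_self_le_rpow_one_add (s := r / s - 1)
      (by have : 0 ≤ r / s := by positivity
          linarith) hp.le
    rw [add_sub_cancel, Real.div_rpow hr h0.le, le_div_iff₀ (by positivity)] at h1
    have h2 : s ^ p = s ^ (p - 1) * s := by
      rw [← Real.rpow_add_one h0.ne']; simp
    have h3 : (1 + p * (r / s - 1)) * s ^ p = s ^ p - p * s ^ (p - 1) * (s - r) := by
      rw [h2]; field_simp; ring
    linarith

/-- For p < 2 the function t^{p-1} is not Lipschitz at zero. The extra factor r compensates: the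
left side is at most |s^p - r^p|, to which the tangent-line inequality applies. -/
theorem abs_rpow_sub_mul_le {p r s : ℝ} (hp₁ : 1 < p) (hp₃ : p < 3) (hr : 0 ≤ r) (hs : 0 ≤ s) :
    |s ^ (p - 1) - r ^ (p - 1)| * r ≤ p * (1 + r ^ 2 + s ^ 2) * |s - r| := by
  have hpow : ∀ {t : ℝ}, 0 ≤ t → t ^ (p - 1) * t = t ^ p := fun {t} ht => by
    rcases ht.eq_or_lt with h0 | h0
    · rw [← h0, mul_zero, Real.zero_rpow (by linarith)]
    · rw [← Real.rpow_add_one h0.ne']; simp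
  have h1 := rpow_le_one_add_sq hp₁ hp₃ hr
  have h2 := rpow_le_one_add_sq hp₁ hp₃ hs
  have hr' := hpow hr
  have hs' := hpow hs
  rcases le_total r s with h | h
  · have hm := Real.rpow_le_rpow hr h (by linarith : 0 ≤ p - 1)
    rw [abs_of_nonneg (by linarith), abs_of_nonneg (by linarith)]
    have h3 := rpow_sub_rpow_le hp₁ hr h
    have h4 : 0 ≤ s ^ (p - 1) * (s - r) := mul_nonneg (by positivity) (by linarith)
    have h5 : p * s ^ (p - 1) * (s - r) ≤ p * (1 + r ^ 2 + s ^ 2) * (s - r) := by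
      have : 0 ≤ s - r := by linarith
      gcongr
      nlinarith [sq_nonneg r]
    nlinarith
  · have hm := Real.rpow_le_rpow hs h (by linarith : 0 ≤ p - 1)
    rw [abs_of_nonpos (by linarith), abs_of_nonpos (by linarith)]
    have h3 := rpow_sub_rpow_le hp₁ hs h
    have h4 : s ^ (p - 1) * s ≤ s ^ (p - 1) * r := mul_le_mul_of_nonneg_left h (by positivity)
    have h5 : p * r ^ (p - 1) * (r - s) ≤ p * (1 + r ^ 2 + s ^ 2) * (r - s) := by
      have : 0 ≤ r - s := by linarith
      gcongr
      nlinarith [sq_nonneg s]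
    nlinarith

theorem norm_rpow_mul_sub_le {p : ℝ} (hp₁ : 1 < p) (hp₃ : p < 3) (z w : ℂ) :
    ‖((‖w‖ ^ (p - 1) : ℝ) : ℂ) * w - ((‖z‖ ^ (p - 1) : ℝ) : ℂ) * z‖ ≤
      (1 + p) * (1 + ‖z‖ ^ 2 + ‖w‖ ^ 2) * ‖w - z‖ := by
  have e : ((‖w‖ ^ (p - 1) : ℝ) : ℂ) * w - ((‖z‖ ^ (p - 1) : ℝ) : ℂ) * z =
      ((‖w‖ ^ (p - 1) : ℝ) : ℂ) * (w - z) + ((‖w‖ ^ (p - 1) - ‖z‖ ^ (p - 1) : ℝ) : ℂ) * z := by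
    push_cast; ring
  rw [e]
  refine (norm_add_le _ _).trans ?_
  rw [norm_mul, norm_mul, Complex.norm_real, Complex.norm_real, Real.norm_of_nonneg (by positivity),
    Real.norm_eq_abs]
  have h1 := abs_rpow_sub_mul_le hp₁ hp₃ (norm_nonneg z) (norm_nonneg w)
  have h2 := rpow_le_one_add_sq hp₁ hp₃ (norm_nonneg w)
  have h3 := abs_norm_sub_norm_le w z
  have h4 : p * (1 + ‖z‖ ^ 2 + ‖w‖ ^ 2) * |‖w‖ - ‖z‖| ≤ p * (1 + ‖z‖ ^ 2 + ‖w‖ ^ 2) * ‖w - z‖ := by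
    gcongr
  have h5 : ‖w‖ ^ (p - 1) * ‖w - z‖ ≤ (1 + ‖z‖ ^ 2 + ‖w‖ ^ 2) * ‖w - z‖ := by
    gcongr
    nlinarith [sq_nonneg ‖z‖]
  linarith

/-- Convexity of |z|^{p+1}/(p + 1), whose gradient is |z|^{p-1}z. It reduces to Young's inequality
for |z|^p |w| with exponents (p + 1)/p and p + 1. -/
theorem rpow_mul_re_le {p : ℝ} (hp : 1 < p) (z w : ℂ) :
    ‖z‖ ^ (p - 1) * (z * conj (w - z)).re ≤ (‖w‖ ^ (p + 1) - ‖z‖ ^ (p + 1)) / (p + 1) := by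
  rcases eq_or_ne z 0 with rfl | hz
  · rw [norm_zero, Real.zero_rpow (by linarith), Real.zero_rpow (by linarith)]
    simp only [zero_mul, sub_zero]
    positivity
  have hz' : 0 < ‖z‖ := norm_pos_iff.2 hz
  have e1 : (z * conj (w - z)).re = (z * conj w).re - ‖z‖ ^ 2 := by
    rw [map_sub, mul_sub, Complex.sub_re, Complex.mul_conj z, Complex.normSq_eq_norm_sq,
      Complex.ofReal_re]
  have e2 : (z * conj w).re ≤ ‖z‖ * ‖w‖ := by
    refine (Complex.re_le_norm _).trans ?_
    rw [norm_mul, RCLike.norm_conj]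
  have e3 : ‖z‖ ^ (p - 1) * ‖z‖ = ‖z‖ ^ p := by
    rw [← Real.rpow_add_one hz'.ne']; simp
  have e4 : ‖z‖ ^ p * ‖z‖ = ‖z‖ ^ (p + 1) := by rw [← Real.rpow_add_one hz'.ne']
  have hconj : ((p + 1) / p).HolderConjugate (p + 1) := by
    refine Real.holderConjugate_iff.2 ⟨?_, ?_⟩
    · rw [lt_div_iff₀ (by linarith)]; linarith
    · field_simp
  have y := Real.young_inequality_of_nonneg (a := ‖z‖ ^ p) (b := ‖w‖) (by positivity)
    (norm_nonneg w) hconj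
  rw [← Real.rpow_mul hz'.le, mul_div_cancel₀ _ (by linarith)] at y
  have e5 : ‖z‖ ^ (p + 1) / ((p + 1) / p) = ‖z‖ ^ (p + 1) - ‖z‖ ^ (p + 1) / (p + 1) := by
    field_simp; ring
  rw [e5] at y
  rw [e1, sub_div]
  have h1 : ‖z‖ ^ (p - 1) * (z * conj w).re ≤ ‖z‖ ^ (p - 1) * (‖z‖ * ‖w‖) := by gcongr
  rw [← mul_assoc, e3] at h1
  have h2 : ‖z‖ ^ (p - 1) * ‖z‖ ^ 2 = ‖z‖ ^ (p + 1) := by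
    rw [sq, ← mul_assoc, e3, e4]
  rw [mul_sub, h2]
  linarith

/-- The first-order Taylor formula for `|z|^{p+1} / (p+1)`. -/
theorem abs_power_remainder_le {p : ℝ} (hp₁ : 1 < p) (hp₃ : p < 3) (z w : ℂ) :
    |‖z‖ ^ (p - 1) * (z * conj (w - z)).re - (‖w‖ ^ (p + 1) - ‖z‖ ^ (p + 1)) / (p + 1)| ≤
      (1 + p) * (1 + ‖z‖ ^ 2 + ‖w‖ ^ 2) * ‖w - z‖ ^ 2 := by
  -- Convexity at z and at w traps the remainder between zero and the difference of the two linear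
  -- terms, and the Lipschitz bound makes that difference quadratic in w - z. No second derivative
  -- is needed.
  have h1 := rpow_mul_re_le hp₁ z w
  have h2 := rpow_mul_re_le hp₁ w z
  have h3 := norm_rpow_mul_sub_le hp₁ hp₃ z w
  have h4 : ‖w‖ ^ (p - 1) * (w * conj (w - z)).re - ‖z‖ ^ (p - 1) * (z * conj (w - z)).re ≤
      (1 + p) * (1 + ‖z‖ ^ 2 + ‖w‖ ^ 2) * ‖w - z‖ ^ 2 := by
    have e : ‖w‖ ^ (p - 1) * (w * conj (w - z)).re - ‖z‖ ^ (p - 1) * (z * conj (w - z)).re =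
        ((((‖w‖ ^ (p - 1) : ℝ) : ℂ) * w - ((‖z‖ ^ (p - 1) : ℝ) : ℂ) * z) * conj (w - z)).re := by
      rw [sub_mul, mul_assoc, mul_assoc, Complex.sub_re, Complex.re_ofReal_mul,
        Complex.re_ofReal_mul]
    rw [e]
    refine (Complex.re_le_norm _).trans ?_
    rw [norm_mul, RCLike.norm_conj, sq ‖w - z‖, ← mul_assoc]
    gcongr
  have h5 : (w * conj (z - w)).re = -(w * conj (w - z)).re := by
    rw [← neg_sub, map_neg, mul_neg, Complex.neg_re]
  rw [h5] at h2
  have h6 : (‖z‖ ^ (p + 1) - ‖w‖ ^ (p + 1)) / (p + 1) =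
      -((‖w‖ ^ (p + 1) - ‖z‖ ^ (p + 1)) / (p + 1)) := by ring
  rw [h6] at h2
  rw [abs_of_nonpos (by linarith)]
  linarith

/-! ### Quadratic remainders -/

/-- Let d = u(· + h e_j) - u. The error is controlled by ‖d‖₂² and by ‖d‖₄² ≤ C ‖d‖₂ ‖∇d‖₂. In each
product one factor ‖d‖₂ is O(h), while the other factor tends to zero by continuity of translations
in L². Hence the integral is o(h). -/
theorem tendsto_remainder {u : L2} {v : Fin 2 → L2} (hv : HasGradient u fun i => v i) {j : Fin 2}
    (hw : (𝓕 (v j) : L2) =ᵐ[volume] fun ξ => (2 * π * Complex.I * (ξ j : ℂ)) * (𝓕 u : L2) ξ)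
    {φ : Plane → ℝ} {M : ℝ} (hM : ∀ x, |φ x| ≤ M) {β : Plane → ℝ} (hβ : MemLp β 2 volume) {K : ℝ}
    {E : ℝ → Plane → ℝ}
    (hE : ∀ h x, |E h x| ≤ K * (1 + |β x| + ‖u (x + h • basisVec j)‖ ^ 2) *
      ‖u (x + h • basisVec j) - u x‖ ^ 2) :
    Tendsto (fun h : ℝ => h⁻¹ * ∫ x, φ x * E h x) (𝓝[≠] 0) (𝓝 0) := by
  have hM0 : 0 ≤ M := (abs_nonneg _).trans (hM 0)
  obtain ⟨C, hC, hC4⟩ := exists_eLpNorm_four_le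
  let d : ℝ → Plane → ℂ := fun h x => u (x + h • basisVec j) - u x
  have hd : ∀ h, HasGradient (d h) fun i x => v i (x + h • basisVec j) - v i x := fun h =>
    (hv.comp_add (h • basisVec j)).sub hv
  let s : ℝ → ℝ≥0∞ := fun h => ∑ i, eLpNorm (fun x => v i (x + h • basisVec j) - v i x) 2 volume
  have hs : Tendsto s (𝓝[≠] 0) (𝓝 0) := by
    have : Tendsto s (𝓝[≠] 0) (𝓝 (∑ _ : Fin 2, 0)) :=
      tendsto_finsetSum _ fun i _ => tendsto_eLpNorm_translate_sub (v i) j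
    simpa using this
  have hu2 : MemLp (fun x => ‖u x‖ ^ 2) 2 volume :=
    (memLp_ofReal_norm_sq hv.memLp_four).of_le (hv.memLp.1.norm.pow 2)
      (Eventually.of_forall fun x => by simp)
  let b : ℝ → Plane → ℝ := fun h x => |β x| + ‖u (x + h • basisVec j)‖ ^ 2
  have hu2h : ∀ h : ℝ, MemLp (fun x => ‖u (x + h • basisVec j)‖ ^ 2) 2 volume := fun h =>
    memLp_comp_add (f := fun x => ‖u x‖ ^ 2) hu2 (h • basisVec j)
  have hb : ∀ h, MemLp (b h) 2 volume := fun h => hβ.abs.add (hu2h h)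
  let B : ℝ≥0∞ := eLpNorm β 2 volume + eLpNorm (fun x => ‖u x‖ ^ 2) 2 volume
  have hB : B ≠ ∞ := (ENNReal.add_lt_top.2 ⟨hβ.2, hu2.2⟩).ne
  have hbB : ∀ h, eLpNorm (b h) 2 volume ≤ B := fun h => by
    refine (eLpNorm_add_le hβ.1.norm (hu2h h).1 (by norm_num)).trans ?_
    refine add_le_add (eLpNorm_norm β).le (le_of_eq ?_)
    exact eLpNorm_comp_add (f := fun x => ‖u x‖ ^ 2) hu2.1 (h • basisVec j)
  let W : ℝ≥0∞ := ENNReal.ofReal ‖v j‖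
  have hd2 : ∀ h, eLpNorm (d h) 2 volume ≤ ENNReal.ofReal |h| * W := fun h => by
    rw [← ENNReal.ofReal_mul (abs_nonneg h)]
    exact (eLpNorm_translate_sub u (h • basisVec j)).trans_le
      (ENNReal.ofReal_le_ofReal (norm_translate_sub_le hw h))
  let ε : ℝ → ℝ≥0∞ := fun h =>
    ENNReal.ofReal (M * K) * (W * eLpNorm (d h) 2 volume + B * (C * (W * s h)))
  have hε : Tendsto ε (𝓝[≠] 0) (𝓝 0) := by
    have hW : W ≠ ∞ := ENNReal.ofReal_ne_top
    have l1 := ENNReal.Tendsto.const_mul (a := W) (tendsto_eLpNorm_translate_sub u j) (Or.inr hW)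
    have l2 := ENNReal.Tendsto.const_mul (a := B) (ENNReal.Tendsto.const_mul (a := C)
      (ENNReal.Tendsto.const_mul (a := W) hs (Or.inr hW)) (Or.inr hC)) (Or.inr hB)
    have l3 := ENNReal.Tendsto.const_mul (a := ENNReal.ofReal (M * K)) (l1.add l2)
      (Or.inr ENNReal.ofReal_ne_top)
    simpa only [mul_zero, add_zero] using l3
  have hmain : ∀ h, eLpNorm (fun x => φ x * E h x) 1 volume ≤ ENNReal.ofReal |h| * ε h := by
    intro h
    have h1 : eLpNorm (fun x => φ x * E h x) 1 volume ≤ ENNReal.ofReal (M * K) *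
        eLpNorm (fun x => ((1 + b h x : ℝ) : ℂ) * d h x * d h x) 1 volume := by
      refine eLpNorm_le_mul_eLpNorm_of_ae_le_mul (Eventually.of_forall fun x => ?_) 1
      rw [norm_mul, norm_mul, norm_mul, Complex.norm_real, mul_assoc M K]
      have hb0 : 0 ≤ 1 + b h x := by positivity
      rw [Real.norm_of_nonneg hb0]
      refine mul_le_mul (hM x) ((hE h x).trans (le_of_eq ?_)) (norm_nonneg _) hM0
      simp only [b, d]
      ring
    have h2 := eLpNorm_potential_mul_le (V := fun x => 1 + b h x) (hb h)
      (Eventually.of_forall fun x => by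
        have hb0 : 0 ≤ b h x := by positivity
        rw [abs_of_nonneg (by positivity), abs_of_nonneg hb0]) (hd h).memLp.1 (hd h).memLp.1
    refine h1.trans ?_
    rw [mul_left_comm]
    gcongr
    refine h2.trans ?_
    rw [mul_add]
    refine add_le_add ?_ ?_
    · rw [← mul_assoc]
      gcongr
      exact hd2 h
    · calc eLpNorm (b h) 2 volume * (eLpNorm (d h) 4 volume * eLpNorm (d h) 4 volume)
          ≤ B * (C * ((ENNReal.ofReal |h| * W) * s h)) := by
            rw [← sq]
            gcongr
            · exact hbB h
            · refine (hC4 (hd h)).trans ?_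
              gcongr
              exact hd2 h
        _ = _ := by ring
  rw [tendsto_iff_edist_tendsto_0]
  refine tendsto_of_tendsto_of_tendsto_of_le_of_le' tendsto_const_nhds hε
    (Eventually.of_forall fun _ => zero_le) ?_
  filter_upwards [self_mem_nhdsWithin] with h hh
  have hh' : 0 < |h| := abs_pos.2 hh
  rw [edist_zero_right, enorm_mul, enorm_inv hh, Real.enorm_eq_ofReal_abs h]
  have h3 : ‖∫ x, φ x * E h x‖ₑ ≤ ENNReal.ofReal |h| * ε h :=
    (enorm_integral_le_lintegral_enorm _).trans (by
      rw [← eLpNorm_one_eq_lintegral_enorm]; exact hmain h)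
  refine (mul_le_mul_right h3 _).trans (le_of_eq ?_)
  rw [← mul_assoc, ENNReal.inv_mul_cancel (by simpa using hh) ENNReal.ofReal_ne_top, one_mul]

/-- Symmetric differences of quadratic remainders are negligible. -/
theorem tendsto_symm_remainder {φ : Plane → ℝ} {E : ℝ → Plane → ℝ}
    (h : Tendsto (fun h : ℝ => h⁻¹ * ∫ x, φ x * E h x) (𝓝[≠] 0) (𝓝 0)) :
    Tendsto (fun h : ℝ => (2 * h)⁻¹ * ((∫ x, φ x * E h x) - ∫ x, φ x * E (-h) x))
      (𝓝[≠] 0) (𝓝 0) := by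
  have h1 := (h.add (h.comp tendsto_neg_nhdsNE_zero)).const_mul (1 / 2)
  rw [add_zero, mul_zero] at h1
  refine h1.congr' ?_
  filter_upwards [self_mem_nhdsWithin] with r hr
  have hr' : r ≠ 0 := hr
  simp only [Function.comp_apply]
  field_simp
  ring

/-- A central difference is the forward increment for h minus the one for -h. Replacing each by Y
costs only a negligible quadratic remainder. For the power term Y is the increment of |u|^{p+1}/(p +
1); for the nonlocal term it is the potential times half the increment of |u|². -/
theorem tendsto_sub_of_remainder {u : L2} {v : Fin 2 → L2} (hv : HasGradient u fun i => v i)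
    {j : Fin 2}
    (hw : (𝓕 (v j) : L2) =ᵐ[volume] fun ξ => (2 * π * Complex.I * (ξ j : ℂ)) * (𝓕 u : L2) ξ)
    {φ : Plane → ℝ} (hφ : Continuous φ) {M : ℝ} (hM : ∀ x, |φ x| ≤ M) {β : Plane → ℝ}
    (hβ : MemLp β 2 volume) {V : Plane → ℝ} (hV : AEStronglyMeasurable V volume)
    (hVβ : ∀ᵐ x, |V x| ≤ 1 + |β x|) {K : ℝ} {Y : ℝ → Plane → ℝ}
    (hY : ∀ h, Integrable (Y h) volume)
    (hE : ∀ h x, |V x * (u x * conj (u (x + h • basisVec j) - u x)).re - Y h x| ≤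
      K * (1 + |β x| + ‖u (x + h • basisVec j)‖ ^ 2) * ‖u (x + h • basisVec j) - u x‖ ^ 2) :
    Tendsto (fun h : ℝ =>
      (2 * h)⁻¹ * (∫ x, φ x * (V x *
        (u x * conj (u (x + h • basisVec j) - u (x + (-h) • basisVec j))).re)) -
      (2 * h)⁻¹ * ∫ x, φ x * (Y h x - Y (-h) x)) (𝓝[≠] 0) (𝓝 0) := by
  have h1 := tendsto_symm_remainder (tendsto_remainder hv hw hM hβ hE)
  refine h1.congr fun h => ?_
  have hX : ∀ h : ℝ, Integrable
      (fun x => V x * (u x * conj (u (x + h • basisVec j) - u x)).re) volume := fun h => by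
    have hd := (hv.comp_add (h • basisVec j)).sub hv
    have h2 := (integrable_potential_mul hV hβ hVβ hv.memLp hd.conj.memLp hv.memLp_four
      hd.conj.memLp_four).re
    refine h2.congr (Eventually.of_forall fun x => ?_)
    simp only [RCLike.re_eq_complex_re, mul_assoc, Complex.re_ofReal_mul]
  have hb : ∀ {k : Plane → ℝ}, Integrable k volume → Integrable (fun x => φ x * k x) volume :=
    fun hk => hk.bdd_mul hφ.aestronglyMeasurable (Eventually.of_forall hM)
  have hE' : ∀ h : ℝ, Integrable (fun x => φ x *
      (V x * (u x * conj (u (x + h • basisVec j) - u x)).re - Y h x)) volume := fun h =>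
    hb ((hX h).sub (hY h))
  have hY' : Integrable (fun x => φ x * (Y h x - Y (-h) x)) volume := hb ((hY h).sub (hY (-h)))
  rw [← mul_sub, ← integral_sub (hE' h) (hE' (-h))]
  congr 1
  have hS : Integrable (fun x =>
      φ x * (V x * (u x * conj (u (x + h • basisVec j) - u x)).re - Y h x) -
      φ x * (V x * (u x * conj (u (x + (-h) • basisVec j) - u x)).re - Y (-h) x)) volume :=
    (hE' h).sub (hE' (-h))
  rw [eq_sub_iff_add_eq, ← integral_add hS hY']
  refine integral_congr_ae (Eventually.of_forall fun x => ?_)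
  simp only [map_sub, mul_sub, Complex.sub_re]
  ring

/-- Summation by parts: the difference moves to φ, whose symmetric slope is bounded by one and
converges to c, so G need only be integrable. -/
theorem IsWeight.tendsto_difference {j : Fin 2} {φ c : Plane → ℝ} (hφ : IsWeight j φ c)
    {G : Plane → ℝ} (hG : Integrable G volume) :
    Tendsto (fun h : ℝ => (2 * h)⁻¹ * ∫ x, φ x * (G (x + h • basisVec j) -
        G (x + (-h) • basisVec j))) (𝓝[≠] 0) (𝓝 (-∫ x, c x * G x)) := by
  obtain ⟨M, hM⟩ := hφ.bounded
  have hc := hφ.contDiff.continuous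
  have h0 := tendsto_integral_mul_of_L1 (l := 𝓝[≠] (0 : ℝ))
    (q := fun h x => (2 * h)⁻¹ * (φ (x + h • basisVec j) - φ (x + (-h) • basisVec j))) (q₀ := c)
    (F := fun _ => G) (f := G) (K := 1)
    (fun h => by
      have : Continuous fun x => (2 * h)⁻¹ * (φ (x + h • basisVec j) - φ (x + (-h) • basisVec j)) := by
        fun_prop
      exact this.aestronglyMeasurable)
    (fun h x => by
      have := hφ.abs_sub_le x h (-h)
      rw [sub_neg_eq_add, ← two_mul] at this
      rw [abs_mul, abs_inv]
      exact (mul_le_mul_of_nonneg_left this (by positivity)).trans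
        (inv_mul_le_one_of_le₀ le_rfl (abs_nonneg _)))
    (Eventually.of_forall hφ.tendsto_symm_slope) hG (fun _ => hG) (by simp)
  refine h0.neg.congr fun h => ?_
  have hGh : ∀ h : ℝ, Integrable (fun x => φ x * G (x + h • basisVec j)) volume := fun h =>
    (hG.comp_add_right (h • basisVec j)).bdd_mul hc.aestronglyMeasurable (Eventually.of_forall hM)
  have hGh' : ∀ h : ℝ, Integrable (fun x => φ (x + h • basisVec j) * G x) volume := fun h =>
    hG.bdd_mul (hc.comp (continuous_id.add continuous_const)).aestronglyMeasurable
      (Eventually.of_forall fun x => hM _)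
  have e : ∀ h : ℝ, ∫ x, φ x * G (x + h • basisVec j) = ∫ x, φ (x + (-h) • basisVec j) * G x := by
    intro h
    rw [← integral_add_right_eq_self _ (-(h • basisVec j))]
    simp
  simp_rw [mul_assoc, integral_const_mul, mul_sub, sub_mul]
  rw [integral_sub (hGh h) (hGh (-h)), integral_sub (hGh' h) (hGh' (-h)), e h, e (-h), neg_neg]
  ring

theorem integrable_norm_rpow {p : ℝ} (hp₁ : 1 < p) (hp₃ : p < 3) {u : L2} {v : Fin 2 → Plane → ℂ}
    (hv : HasGradient u v) : Integrable (fun x => ‖u x‖ ^ (p + 1)) volume := by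
  have hu2 : MemLp (fun x => ‖u x‖ ^ 2) 2 volume :=
    (memLp_ofReal_norm_sq hv.memLp_four).of_le (hv.memLp.1.norm.pow 2)
      (Eventually.of_forall fun x => by simp)
  have hpm : AEStronglyMeasurable (fun x => ‖u x‖ ^ (p - 1)) volume :=
    (Real.continuous_rpow_const (by linarith)).comp_aestronglyMeasurable hv.memLp.1.norm
  have h := (integrable_potential_mul (V := fun x => ‖u x‖ ^ (p - 1)) hpm hu2
    (Eventually.of_forall fun x => by
      rw [abs_of_nonneg (by positivity), abs_of_nonneg (by positivity)]
      exact rpow_le_one_add_sq hp₁ hp₃ (norm_nonneg _)) hv.memLp hv.memLp hv.memLp_four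
      hv.memLp_four).norm
  refine h.congr (Eventually.of_forall fun x => ?_)
  simp only [norm_mul, Complex.norm_real]
  rw [Real.norm_of_nonneg (by positivity)]
  rcases (norm_nonneg (u x)).eq_or_lt with h0 | h0
  · rw [← h0, mul_zero, Real.zero_rpow (by linarith)]
  · rw [← Real.rpow_add_one h0.ne', ← Real.rpow_add_one h0.ne']
    congr 1
    ring

/-- The power nonlinearity in the limit of vanishing increment. -/
theorem IsWeight.tendsto_power {p : ℝ} (hp₁ : 1 < p) (hp₃ : p < 3) {u : L2} {v : Fin 2 → L2}
    (hv : HasGradient u fun i => v i) {j : Fin 2}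
    (hw : (𝓕 (v j) : L2) =ᵐ[volume] fun ξ => (2 * π * Complex.I * (ξ j : ℂ)) * (𝓕 u : L2) ξ)
    {φ c : Plane → ℝ} (hφ : IsWeight j φ c) :
    Tendsto (fun h : ℝ => (2 * h)⁻¹ * ∫ x, φ x * (‖u x‖ ^ (p - 1) *
        (u x * conj (u (x + h • basisVec j) - u (x + (-h) • basisVec j))).re)) (𝓝[≠] 0)
      (𝓝 (-(p + 1)⁻¹ * ∫ x, c x * ‖u x‖ ^ (p + 1))) := by
  obtain ⟨M, hM⟩ := hφ.bounded
  have hu2 : MemLp (fun x => ‖u x‖ ^ 2) 2 volume :=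
    (memLp_ofReal_norm_sq hv.memLp_four).of_le (hv.memLp.1.norm.pow 2)
      (Eventually.of_forall fun x => by simp)
  have hpm : AEStronglyMeasurable (fun x => ‖u x‖ ^ (p - 1)) volume :=
    (Real.continuous_rpow_const (by linarith)).comp_aestronglyMeasurable hv.memLp.1.norm
  have hG : Integrable (fun x => ‖u x‖ ^ (p + 1) / (p + 1)) volume :=
    (integrable_norm_rpow hp₁ hp₃ hv).div_const _
  have h1 := tendsto_sub_of_remainder hv hw hφ.contDiff.continuous hM hu2 hpm
    (Eventually.of_forall fun x => by
      rw [abs_of_nonneg (by positivity), abs_of_nonneg (by positivity)]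
      exact rpow_le_one_add_sq hp₁ hp₃ (norm_nonneg _)) (K := 1 + p)
    (Y := fun h x => ‖u (x + h • basisVec j)‖ ^ (p + 1) / (p + 1) - ‖u x‖ ^ (p + 1) / (p + 1))
    (fun h => (hG.comp_add_right (h • basisVec j)).sub hG)
    (fun h x => by
      rw [← sub_div, abs_of_nonneg (a := ‖u x‖ ^ 2) (by positivity)]
      exact abs_power_remainder_le hp₁ hp₃ _ _)
  have h2 := h1.add (hφ.tendsto_difference hG)
  have e : -∫ x, c x * (‖u x‖ ^ (p + 1) / (p + 1)) = -(p + 1)⁻¹ * ∫ x, c x * ‖u x‖ ^ (p + 1) := by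
    rw [neg_mul, ← integral_const_mul]
    congr 2
    ext x
    ring
  rw [e, zero_add] at h2
  refine h2.congr fun h => ?_
  simp only [sub_sub_sub_cancel_right, sub_add_cancel]

/-! ### The nonlocal term -/

/-- The quantitative form of |∇m| = O(1/|ξ|) for a symbol m of degree zero. The numerator of m(η) -
m(ξ) factors as (η₀ξ₁ - η₁ξ₀)(η₀ξ₁ + η₁ξ₀). The first factor is unchanged when ξ is replaced by ξ -
η, hence at most |η||ξ - η|; the second is at most |η||ξ|. -/
theorem abs_symbol_sub_mul_norm_le (ξ η : Plane) : |symbol η - symbol ξ| * ‖ξ‖ ≤ ‖ξ - η‖ := by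
  rcases eq_or_ne ξ 0 with rfl | hξ
  · simp
  rcases eq_or_ne η 0 with rfl | hη
  -- Division by zero gives the symbol the value 0 at the origin, and the bound m ≤ 1 suffices
  -- there.
  · have h0 : symbol 0 = 0 := by simp [symbol]
    rw [h0, zero_sub, abs_neg, abs_of_nonneg (symbol_nonneg ξ), sub_zero]
    exact mul_le_of_le_one_left (norm_nonneg _) (symbol_le_one ξ)
  have hξ' : 0 < ‖ξ‖ := norm_pos_iff.2 hξ
  have hη' : 0 < ‖η‖ := norm_pos_iff.2 hη
  have nξ : ‖ξ‖ ^ 2 = ξ 0 ^ 2 + ξ 1 ^ 2 := by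
    rw [EuclideanSpace.real_norm_sq_eq, Fin.sum_univ_two]
  have nη : ‖η‖ ^ 2 = η 0 ^ 2 + η 1 ^ 2 := by
    rw [EuclideanSpace.real_norm_sq_eq, Fin.sum_univ_two]
  have nd : ‖ξ - η‖ ^ 2 = (ξ 0 - η 0) ^ 2 + (ξ 1 - η 1) ^ 2 := by
    rw [EuclideanSpace.real_norm_sq_eq, Fin.sum_univ_two]; simp
  have e : symbol η - symbol ξ = ((η 0 * ξ 1 - η 1 * ξ 0) * (η 0 * ξ 1 + η 1 * ξ 0)) /
      (‖η‖ ^ 2 * ‖ξ‖ ^ 2) := by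
    unfold symbol
    rw [div_sub_div _ _ (by positivity) (by positivity), nξ, nη]
    congr 1
    ring
  have h1 : |η 0 * ξ 1 - η 1 * ξ 0| ≤ ‖η‖ * ‖ξ - η‖ := by
    refine abs_le_of_sq_le_sq ?_ (by positivity)
    rw [mul_pow, nη, nd]
    nlinarith [sq_nonneg (η 0 * (ξ 0 - η 0) + η 1 * (ξ 1 - η 1))]
  have h2 : |η 0 * ξ 1 + η 1 * ξ 0| ≤ ‖η‖ * ‖ξ‖ := by
    refine abs_le_of_sq_le_sq ?_ (by positivity)
    rw [mul_pow, nη, nξ]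
    nlinarith [sq_nonneg (η 0 * ξ 0 - η 1 * ξ 1)]
  rw [e, abs_div, abs_mul, abs_of_pos (by positivity : 0 < ‖η‖ ^ 2 * ‖ξ‖ ^ 2), div_mul_eq_mul_div,
    div_le_iff₀ (by positivity)]
  calc |η 0 * ξ 1 - η 1 * ξ 0| * |η 0 * ξ 1 + η 1 * ξ 0| * ‖ξ‖
      ≤ (‖η‖ * ‖ξ - η‖) * (‖η‖ * ‖ξ‖) * ‖ξ‖ := by gcongr
    _ = _ := by ring

/-- The weight `sin (2π t x_j) / (2π t)`. -/
def sinWeight (t : ℝ) (j : Fin 2) (x : Plane) : ℝ := sin (2 * π * t * x j) / (2 * π * t)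

theorem isWeight_sinWeight {t : ℝ} (ht : t ≠ 0) (j : Fin 2) :
    IsWeight j (sinWeight t j) fun x => cos (2 * π * t * x j) := by
  have h0 : 2 * π * t ≠ 0 := by have := pi_ne_zero; positivity
  have hcd : ContDiff ℝ ((⊤ : ℕ∞) : WithTop ℕ∞) (sinWeight t j) := by
    unfold sinWeight
    fun_prop
  refine ⟨hcd, ⟨|2 * π * t|⁻¹, fun x => ?_⟩, fun i x => ?_, fun x => abs_cos_le_one _⟩
  · rw [sinWeight, abs_div, div_eq_mul_inv]
    exact mul_le_of_le_one_left (by positivity) (abs_sin_le_one _)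
  · have h1 : HasFDerivAt (fun x : Plane => x j) (EuclideanSpace.proj j : Plane →L[ℝ] ℝ) x :=
      (EuclideanSpace.proj j : Plane →L[ℝ] ℝ).hasFDerivAt
    have h2 : HasFDerivAt (sinWeight t j) _ x :=
      ((h1.const_mul (2 * π * t)).sin).mul_const (2 * π * t)⁻¹
    rw [h2.fderiv]
    rcases eq_or_ne i j with rfl | hij
    · simp [basisVec]
      field_simp
    · simp [basisVec, hij, Ne.symm hij]

/-- The kernel of the nonlocal term. -/
def nonlocalKernel (t : ℝ) (j : Fin 2) (ξ : Plane) : ℝ :=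
  -(2 * t)⁻¹ * (ξ j * symbol (ξ + (-t) • basisVec j) - (ξ j - t) * symbol ξ)

/-- Split off s(ξ_j)(m(ξ - t e_j) - m(ξ)): the growth |s(ξ_j)| ≤ C|ξ| is exactly what the symbol
estimate absorbs. A general Lipschitz s serves both the sine at positive step h and the identity in
the limit kernel. -/
theorem abs_commutator_le {s : ℝ → ℝ} {C : ℝ} (hs : ∀ a b, |s a - s b| ≤ C * |a - b|)
    (hs0 : s 0 = 0) (t : ℝ) (j : Fin 2) (ξ : Plane) :
    |s (ξ j) * symbol (ξ + (-t) • basisVec j) - s (ξ j - t) * symbol ξ| ≤ 2 * C * |t| := by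
  have hC : 0 ≤ C := by simpa using (abs_nonneg _).trans (hs 1 0)
  have h1 : |s (ξ j)| ≤ C * ‖ξ‖ := by
    have h2 := hs (ξ j) 0
    rw [hs0, sub_zero, sub_zero] at h2
    exact h2.trans (mul_le_mul_of_nonneg_left (PiLp.norm_apply_le ξ j) hC)
  have h2 := abs_symbol_sub_mul_norm_le ξ (ξ + (-t) • basisVec j)
  have h3 : ‖ξ - (ξ + (-t) • basisVec j)‖ = |t| := by
    simp [norm_smul, norm_basisVec]
  rw [h3] at h2
  have h4 := hs (ξ j) (ξ j - t)
  rw [sub_sub_cancel] at h4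
  have e : s (ξ j) * symbol (ξ + (-t) • basisVec j) - s (ξ j - t) * symbol ξ =
      s (ξ j) * (symbol (ξ + (-t) • basisVec j) - symbol ξ) + (s (ξ j) - s (ξ j - t)) * symbol ξ := by
    ring
  rw [e]
  refine (abs_add_le _ _).trans ?_
  rw [abs_mul, abs_mul, abs_of_nonneg (symbol_nonneg ξ)]
  have h5 : |s (ξ j)| * |symbol (ξ + (-t) • basisVec j) - symbol ξ| ≤ C * |t| := by
    calc _ ≤ C * ‖ξ‖ * |symbol (ξ + (-t) • basisVec j) - symbol ξ| := by gcongr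
      _ = C * (|symbol (ξ + (-t) • basisVec j) - symbol ξ| * ‖ξ‖) := by ring
      _ ≤ _ := by gcongr
  have h6 : |s (ξ j) - s (ξ j - t)| * symbol ξ ≤ C * |t| :=
    (mul_le_of_le_one_right (abs_nonneg _) (symbol_le_one ξ)).trans h4
  linarith

/-- The sine is a combination of two plane waves, and each modulation is a translation in frequency.
The constant is 1/(2i) from Euler's formula times 1/(2πt). -/
theorem fourier_sinWeight_mul {t : ℝ} {j : Fin 2} {f F : L2}
    (hF : F =ᵐ[volume] fun x => (sinWeight t j x : ℂ) * f x) :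
    (𝓕 F : L2) =ᵐ[volume] fun ξ => (4 * π * Complex.I * t)⁻¹ *
      ((𝓕 f : L2) (ξ + (-t) • basisVec j) - (𝓕 f : L2) (ξ + t • basisVec j)) := by
  let P : L2 := (memLp_modulation (t • basisVec j) f).toLp _
  let N : L2 := (memLp_modulation ((-t) • basisVec j) f).toLp _
  have hP := (memLp_modulation (t • basisVec j) f).coeFn_toLp
  have hN := (memLp_modulation ((-t) • basisVec j) f).coeFn_toLp
  let a : ℂ := (4 * π * Complex.I * t)⁻¹
  have e : F = a • (P - N) := by
    refine Lp.ext ?_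
    filter_upwards [hF, hP, hN, Lp.coeFn_smul a (P - N), Lp.coeFn_sub P N] with x h1 h2 h3 h4 h5
    rw [h1, h4, Pi.smul_apply, h5, Pi.sub_apply, h2, h3, wave_smul_basisVec, wave_smul_basisVec,
      smul_eq_mul, ← sub_mul, ← mul_assoc]
    congr 1
    have e1 : (2 * π * (-t * x j) : ℝ) = -(2 * π * (t * x j)) := by ring
    rw [e1, sinWeight, mul_assoc (2 * π) t (x j), Complex.exp_mul_I, Complex.exp_mul_I]
    push_cast
    rw [Complex.cos_neg, Complex.sin_neg]
    rcases eq_or_ne t 0 with rfl | ht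
    · simp
    have : (t : ℂ) ≠ 0 := by exact_mod_cast ht
    have hpi : (π : ℂ) ≠ 0 := by exact_mod_cast pi_ne_zero
    simp only [a]
    field_simp
    ring
  have e2 : (𝓕 F : L2) = a • (translate (-(t • basisVec j)) (𝓕 f) -
      translate (-((-t) • basisVec j)) (𝓕 f)) := by
    rw [e, FourierTransform.fourier_smul, fourier_sub', fourier_modulation hP,
      fourier_modulation hN]
  rw [e2]
  filter_upwards [Lp.coeFn_smul a (translate (-(t • basisVec j)) (𝓕 f : L2) -
      translate (-((-t) • basisVec j)) (𝓕 f)), Lp.coeFn_sub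
      (translate (-(t • basisVec j)) (𝓕 f : L2)) (translate (-((-t) • basisVec j)) (𝓕 f)),
      coeFn_translate (-(t • basisVec j)) (𝓕 f : L2),
      coeFn_translate (-((-t) • basisVec j)) (𝓕 f : L2)] with ξ h1 h2 h3 h4
  rw [h1, Pi.smul_apply, h2, Pi.sub_apply, h3, h4, smul_eq_mul, neg_smul, neg_neg]

theorem fourier_translate_sub_translate (f : L2) (h : ℝ) (j : Fin 2) :
    (𝓕 (translate (h • basisVec j) f - translate ((-h) • basisVec j) f) : L2) =ᵐ[volume]
      fun ξ => (2 * Complex.I * (sin (2 * π * h * ξ j) : ℝ)) * (𝓕 f : L2) ξ := by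
  rw [fourier_sub']
  filter_upwards [fourier_translate (h • basisVec j) f, fourier_translate ((-h) • basisVec j) f,
    Lp.coeFn_sub (𝓕 (translate (h • basisVec j) f) : L2)
      (𝓕 (translate ((-h) • basisVec j) f))] with ξ h2 h3 h4
  rw [h4, Pi.sub_apply, h2, h3, ← sub_mul]
  congr 1
  rw [wave_smul_basisVec, wave_smul_basisVec]
  have e1 : (2 * π * (-h * ξ j) : ℝ) = -(2 * π * (h * ξ j)) := by ring
  rw [e1, mul_assoc (2 * π) h, Complex.exp_mul_I, Complex.exp_mul_I]
  push_cast
  rw [Complex.cos_neg, Complex.sin_neg]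
  ring

theorem ae_comp_add {P : Plane → Prop} (h : ∀ᵐ x, P x) (a : Plane) : ∀ᵐ x, P (x + a) :=
  (measurePreserving_add_const a).quasiMeasurePreserving.ae h

/-- The correlation of the Fourier transform of `f` with its translate. -/
def correlation (f : L2) (t : ℝ) (j : Fin 2) (ξ : Plane) : ℝ :=
  ((𝓕 f : L2) (ξ + (-t) • basisVec j) * conj ((𝓕 f : L2) ξ)).re

theorem integrable_correlation (f : L2) (t : ℝ) (j : Fin 2) :
    Integrable (correlation f t j) volume :=
  integrable_re_mul_conj (memLp_comp_add (Lp.memLp (𝓕 f : L2)) _) (Lp.memLp _)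

/-- By Plancherel the weight gives the two translates of m 𝓕f by ±t e_j, and the central difference
gives 2i sin(2πhξ_j) 𝓕f. Shifting one of the two resulting integrals by t e_j brings both to the
same correlation, so that only a commutator multiplies it. -/
theorem integral_sinWeight_mul_E₁L2 {t : ℝ} (ht : t ≠ 0) (j : Fin 2) (f : L2) (h : ℝ) :
    ∫ x, sinWeight t j x * (E₁L2 f x *
        conj (f (x + h • basisVec j) - f (x + (-h) • basisVec j))).re =
      -(2 * π * t)⁻¹ * ∫ ξ, (sin (2 * π * h * ξ j) * symbol (ξ + (-t) • basisVec j) -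
        sin (2 * π * h * (ξ j - t)) * symbol ξ) * correlation f t j ξ := by
  have hφ := isWeight_sinWeight ht j
  obtain ⟨M, hM⟩ := hφ.bounded
  have hΦ := memLp_bounded_mul (b := fun x => (sinWeight t j x : ℂ))
    (Complex.continuous_ofReal.comp hφ.contDiff.continuous) (C := M)
    (fun x => by rw [Complex.norm_real]; exact hM x) (E₁L2 f)
  have e1 : ∫ x, sinWeight t j x * (E₁L2 f x *
        conj (f (x + h • basisVec j) - f (x + (-h) • basisVec j))).re =
      ∫ x, (hΦ.toLp _ x *
        conj ((translate (h • basisVec j) f - translate ((-h) • basisVec j) f : L2) x)).re := by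
    refine integral_congr_ae ?_
    filter_upwards [Lp.coeFn_sub (translate (h • basisVec j) f) (translate ((-h) • basisVec j) f),
      coeFn_translate (h • basisVec j) f, coeFn_translate ((-h) • basisVec j) f,
      hΦ.coeFn_toLp] with x h1 h2 h3 h4
    rw [h1, Pi.sub_apply, h2, h3, h4, mul_assoc, Complex.re_ofReal_mul]
  have hsm := fun a : ℝ => ae_comp_add (fourier_E₁L2 f) (a • basisVec j)
  have hb : ∀ {s k : Plane → ℝ}, Measurable s → (∀ ξ, |s ξ| ≤ 1) → Integrable k volume →
      Integrable (fun ξ => s ξ * k ξ) volume := fun hs hs1 hk =>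
    hk.bdd_mul hs.aestronglyMeasurable (Eventually.of_forall hs1)
  have hsin : ∀ a : ℝ, Measurable fun ξ : Plane => sin (2 * π * h * (ξ j - a)) := fun a => by
    fun_prop
  have hsym : ∀ ξ, |symbol ξ| ≤ 1 := fun ξ => by
    rw [abs_of_nonneg (symbol_nonneg ξ)]; exact symbol_le_one ξ
  have hsymt : Measurable fun ξ : Plane => symbol (ξ + (-t) • basisVec j) :=
    measurable_symbol.comp (measurable_add_const _)
  have i1 : Integrable (fun ξ : Plane => sin (2 * π * h * ξ j) *
      (symbol (ξ + (-t) • basisVec j) * correlation f t j ξ)) volume :=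
    hb (by simpa using hsin 0) (fun ξ => abs_sin_le_one _)
      (hb hsymt (fun ξ => hsym _) (integrable_correlation f t j))
  have i2 : Integrable (fun ξ : Plane => sin (2 * π * h * (ξ j - t)) *
      (symbol ξ * correlation f t j ξ)) volume :=
    hb (hsin t) (fun ξ => abs_sin_le_one _)
      (hb measurable_symbol hsym (integrable_correlation f t j))
  have e2 : ∫ ξ : Plane, sin (2 * π * h * (ξ j - t)) * (symbol ξ * correlation f t j ξ) =
      ∫ ξ : Plane, sin (2 * π * h * ξ j) * (symbol (ξ + t • basisVec j) *
        correlation f t j (ξ + t • basisVec j)) := by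
    rw [← integral_add_right_eq_self _ (t • basisVec j)]
    refine integral_congr_ae (Eventually.of_forall fun ξ => ?_)
    simp [basisVec]
  have i3 : Integrable (fun ξ : Plane => sin (2 * π * h * ξ j) * (symbol (ξ + t • basisVec j) *
        correlation f t j (ξ + t • basisVec j))) volume := by
    refine (i2.comp_add_right (t • basisVec j)).congr (Eventually.of_forall fun ξ => ?_)
    simp [basisVec]
  have e3 : ∫ ξ, (sin (2 * π * h * ξ j) * symbol (ξ + (-t) • basisVec j) -
        sin (2 * π * h * (ξ j - t)) * symbol ξ) * correlation f t j ξ =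
      ∫ ξ : Plane, (sin (2 * π * h * ξ j) *
        (symbol (ξ + (-t) • basisVec j) * correlation f t j ξ) -
        sin (2 * π * h * ξ j) * (symbol (ξ + t • basisVec j) *
        correlation f t j (ξ + t • basisVec j))) := by
    rw [integral_sub i1 i3, ← e2, ← integral_sub i1 i2]
    refine integral_congr_ae (Eventually.of_forall fun ξ => ?_)
    simp only
    ring
  rw [e1, ← integral_re_mul_conj_fourier, e3, ← integral_const_mul]
  refine integral_congr_ae ?_
  filter_upwards [fourier_sinWeight_mul hΦ.coeFn_toLp, fourier_translate_sub_translate f h j,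
    hsm t, hsm (-t)] with ξ h1 h2 h3 h4
  rw [h1, h2, h3, h4]
  simp only [correlation]
  have e4 : ξ + t • basisVec j + -t • basisVec j = ξ := by simp
  rw [e4]
  have hpi : (π : ℂ) ≠ 0 := by exact_mod_cast pi_ne_zero
  have htc : (t : ℂ) ≠ 0 := by exact_mod_cast ht
  generalize (𝓕 f : L2) (ξ + (-t) • basisVec j) = a
  generalize (𝓕 f : L2) (ξ + t • basisVec j) = b
  generalize (𝓕 f : L2) ξ = c
  generalize sin (2 * π * h * ξ j) = s
  generalize symbol (ξ + (-t) • basisVec j) = m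
  generalize symbol (ξ + t • basisVec j) = n
  have e5 : (4 * π * Complex.I * t)⁻¹ * (m * a - n * b) * conj (2 * Complex.I * s * c) =
      ((-(2 * π * t)⁻¹ : ℝ) : ℂ) * ((s : ℂ) * ((m : ℂ) * (a * conj c)) -
        (s : ℂ) * ((n : ℂ) * (b * conj c))) := by
    simp only [map_mul, Complex.conj_I, Complex.conj_ofReal, map_ofNat]
    push_cast
    field_simp
    ring
  rw [e5, Complex.re_ofReal_mul, Complex.sub_re, Complex.re_ofReal_mul, Complex.re_ofReal_mul,
    Complex.re_ofReal_mul, Complex.re_ofReal_mul]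
  congr 4
  simp only [Complex.mul_re, Complex.conj_re, Complex.conj_im]
  ring

/-- The nonlocal bilinear term in the limit of vanishing increment. -/
theorem tendsto_sinWeight_mul_E₁L2 {t : ℝ} (ht : t ≠ 0) (j : Fin 2) (f : L2) :
    Tendsto (fun h : ℝ => (2 * h)⁻¹ * ∫ x, sinWeight t j x * (E₁L2 f x *
        conj (f (x + h • basisVec j) - f (x + (-h) • basisVec j))).re) (𝓝[≠] 0)
      (𝓝 (∫ ξ, nonlocalKernel t j ξ * correlation f t j ξ)) := by
  have hsymt : Measurable fun ξ : Plane => symbol (ξ + (-t) • basisVec j) :=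
    measurable_symbol.comp (measurable_add_const _)
  have hpi := pi_pos
  have h0 := tendsto_integral_mul_of_L1 (l := 𝓝[≠] (0 : ℝ))
    (q := fun h ξ => (2 * h)⁻¹ * (-(2 * π * t)⁻¹ *
      (sin (2 * π * h * ξ j) * symbol (ξ + (-t) • basisVec j) -
        sin (2 * π * h * (ξ j - t)) * symbol ξ))) (q₀ := nonlocalKernel t j)
    (F := fun _ => correlation f t j) (f := correlation f t j) (K := 1)
    (fun h => by
      have h1 : Measurable fun ξ : Plane => sin (2 * π * h * ξ j) := by fun_prop
      have h2 : Measurable fun ξ : Plane => sin (2 * π * h * (ξ j - t)) := by fun_prop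
      exact (((h1.mul hsymt).sub (h2.mul measurable_symbol)).const_mul _).const_mul _
        |>.aestronglyMeasurable)
    (fun h ξ => by
      -- The sine has Lipschitz constant 2π|h|, so the commutator bound cancels both 2h and 2πt and
      -- leaves the bound 1.
      have h1 := abs_commutator_le (s := fun a => sin (2 * π * h * a)) (C := 2 * π * |h|)
        (fun a b => by
          refine (abs_sin_sub_sin_le _ _).trans_eq ?_
          rw [← mul_sub, abs_mul, abs_mul, abs_of_pos (by positivity : 0 < 2 * π)])
        (by simp) t j ξ
      rw [abs_mul, abs_mul, abs_neg, abs_inv, abs_inv]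
      calc _ ≤ |2 * h|⁻¹ * (|2 * π * t|⁻¹ * (2 * (2 * π * |h|) * |t|)) := by gcongr
        _ = (|2 * h|⁻¹ * |2 * h|) * (|2 * π * t|⁻¹ * |2 * π * t|) := by
          rw [abs_mul, abs_mul (2 * π), abs_of_pos (by positivity : 0 < 2 * π), abs_two]
          ring
        _ ≤ 1 * 1 := by
          gcongr <;> exact inv_mul_le_one
        _ = 1 := one_mul 1)
    (Eventually.of_forall fun ξ => by
      have h1 : ∀ a : ℝ, Tendsto (fun h : ℝ => h⁻¹ * sin (2 * π * h * a)) (𝓝[≠] 0)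
          (𝓝 (2 * π * a)) := fun a => by
        have h2 : HasDerivAt (fun h : ℝ => sin (2 * π * h * a)) (2 * π * a) 0 := by
          have h3 : HasDerivAt (fun h : ℝ => 2 * π * h * a) (2 * π * a) 0 := by
            simpa using ((hasDerivAt_id (0 : ℝ)).const_mul (2 * π)).mul_const a
          simpa using h3.sin
        simpa using h2.tendsto_slope_zero
      have h2 := (((h1 (ξ j)).mul_const (symbol (ξ + (-t) • basisVec j))).sub
        ((h1 (ξ j - t)).mul_const (symbol ξ))).const_mul (-(4 * π * t)⁻¹)
      have e : -(4 * π * t)⁻¹ * (2 * π * ξ j * symbol (ξ + (-t) • basisVec j) -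
          2 * π * (ξ j - t) * symbol ξ) = nonlocalKernel t j ξ := by
        rw [nonlocalKernel]
        field_simp
        ring
      rw [e] at h2
      refine h2.congr fun h => ?_
      simp only [mul_inv]
      ring)
    (integrable_correlation f t j) (fun _ => integrable_correlation f t j) (by simp)
  refine h0.congr fun h => ?_
  rw [integral_sinWeight_mul_E₁L2 ht, ← integral_const_mul, ← integral_const_mul]
  refine integral_congr_ae (Eventually.of_forall fun ξ => ?_)
  simp only
  ring

/-- The nonlocal nonlinearity in the limit of vanishing increment. -/
theorem tendsto_potential {u : L2} {v : Fin 2 → L2} (hv : HasGradient u fun i => v i) {j : Fin 2}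
    (hw : (𝓕 (v j) : L2) =ᵐ[volume] fun ξ => (2 * π * Complex.I * (ξ j : ℂ)) * (𝓕 u : L2) ξ)
    {t : ℝ} (ht : t ≠ 0) :
    Tendsto (fun h : ℝ => (2 * h)⁻¹ * ∫ x, sinWeight t j x * (potential u x *
        (u x * conj (u (x + h • basisVec j) - u (x + (-h) • basisVec j))).re)) (𝓝[≠] 0)
      (𝓝 (1 / 2 * ∫ ξ, nonlocalKernel t j ξ *
        correlation ((memLp_ofReal_norm_sq hv.memLp_four).toLp _) t j ξ)) := by
  have hφ := isWeight_sinWeight ht j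
  obtain ⟨M, hM⟩ := hφ.bounded
  have hu4 := hv.memLp_four
  have hV := memLp_potential hu4
  have hu2 : MemLp (fun x => ‖u x‖ ^ 2) 2 volume :=
    (memLp_ofReal_norm_sq hv.memLp_four).of_le (hv.memLp.1.norm.pow 2)
      (Eventually.of_forall fun x => by simp)
  -- By polarization Re(u conj(w - u)) = ½(|w|² - |u|²) - ½|w - u|². Up to the quadratic remainder
  -- the term is therefore half the bilinear expression in E₁(ρ) and the central difference of ρ,
  -- where ρ = |u|².
  have h1 := tendsto_sub_of_remainder hv hw hφ.contDiff.continuous hM hV hV.1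
    (Eventually.of_forall fun x => by linarith) (K := 1)
    (Y := fun h x => potential u x * ((1 / 2) * (‖u (x + h • basisVec j)‖ ^ 2 - ‖u x‖ ^ 2)))
    (fun h => hV.integrable_mul (((memLp_comp_add hu2 (h • basisVec j)).sub hu2).const_mul (1 / 2)))
    (fun h x => by
      have e : (u x * conj (u (x + h • basisVec j) - u x)).re =
          1 / 2 * (‖u (x + h • basisVec j)‖ ^ 2 - ‖u x‖ ^ 2) -
            1 / 2 * ‖u (x + h • basisVec j) - u x‖ ^ 2 := by
        simp only [← Complex.normSq_eq_norm_sq, Complex.normSq_apply, Complex.mul_re,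
          Complex.conj_re, Complex.conj_im, Complex.sub_re, Complex.sub_im]
        ring
      rw [e, ← mul_sub, sub_sub_cancel_left, abs_mul, abs_neg,
        abs_of_nonneg (by positivity : 0 ≤ 1 / 2 * ‖u (x + h • basisVec j) - u x‖ ^ 2),
        ← mul_assoc, one_mul]
      refine mul_le_mul_of_nonneg_right ?_ (by positivity)
      have := abs_nonneg (potential u x)
      nlinarith [sq_nonneg ‖u (x + h • basisVec j)‖])
  have h2 := h1.add ((tendsto_sinWeight_mul_E₁L2 ht j
    ((memLp_ofReal_norm_sq hu4).toLp _)).const_mul (1 / 2))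
  rw [zero_add] at h2
  refine h2.congr fun h => ?_
  have hsm := fun a : ℝ => ae_comp_add (memLp_ofReal_norm_sq hu4).coeFn_toLp (a • basisVec j)
  rw [sub_add_eq_add_sub, sub_eq_iff_eq_add, add_right_inj, mul_left_comm, ← integral_const_mul]
  congr 1
  refine integral_congr_ae ?_
  filter_upwards [coe_potential hu4, hsm h, hsm (-h)] with x h3 h4 h5
  rw [h3, h4, h5, ← Complex.ofReal_sub, Complex.conj_ofReal, ← Complex.ofReal_mul,
    Complex.ofReal_re]
  ring

/-! ### Vanishing frequency -/

theorem symbol_eq (ξ : Plane) : symbol ξ = ξ 0 ^ 2 / (ξ 0 ^ 2 + ξ 1 ^ 2) := by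
  rw [symbol, EuclideanSpace.real_norm_sq_eq, Fin.sum_univ_two]

/-- The derivative `∂_j` of the symbol, times `ξ_j`. -/
def symbolDeriv (j : Fin 2) (ξ : Plane) : ℝ :=
  (if j = 0 then 1 else -1) * (2 * ξ 0 ^ 2 * ξ 1 ^ 2 / (ξ 0 ^ 2 + ξ 1 ^ 2) ^ 2)

theorem hasDerivAt_symbol {ξ : Plane} (hξ : ξ ≠ 0) (j : Fin 2) :
    HasDerivAt (fun s : ℝ => ξ j * symbol (ξ + s • basisVec j)) (symbolDeriv j ξ) 0 := by
  have hd : ξ 0 ^ 2 + ξ 1 ^ 2 ≠ 0 := by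
    have : 0 < ‖ξ‖ ^ 2 := by have := norm_pos_iff.2 hξ; positivity
    rw [EuclideanSpace.real_norm_sq_eq, Fin.sum_univ_two] at this
    exact this.ne'
  simp_rw [symbol_eq]
  have hq : ∀ a : ℝ, HasDerivAt (fun s : ℝ => (a + s) ^ 2) (2 * a) 0 := fun a => by
    have h := ((hasDerivAt_id (0 : ℝ)).const_add a).pow 2
    simp only [id, add_zero, mul_one, Nat.cast_ofNat, pow_one, Nat.add_one_sub_one] at h
    exact h
  rcases Fin.exists_fin_two.1 ⟨j, rfl⟩ with rfl | rfl
  · have h := (((hq (ξ 0)).div ((hq (ξ 0)).add_const (ξ 1 ^ 2)) (by simpa using hd)).const_mul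
      (ξ 0))
    refine (h.congr_deriv ?_).congr_of_eventuallyEq (Eventually.of_forall fun s => ?_)
    · simp only [symbolDeriv, if_true, add_zero]
      field_simp
      ring
    · simp [basisVec]
  · have h := (((hasDerivAt_const (0 : ℝ) (ξ 0 ^ 2)).div ((hq (ξ 1)).const_add (ξ 0 ^ 2))
      (by simpa using hd)).const_mul (ξ 1))
    refine (h.congr_deriv ?_).congr_of_eventuallyEq (Eventually.of_forall fun s => ?_)
    · simp only [symbolDeriv, if_neg (by decide : ¬ (1 : Fin 2) = 0), add_zero]
      field_simp
      ring
    · simp [basisVec]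

theorem abs_symbolDeriv_le (j : Fin 2) (ξ : Plane) : |symbolDeriv j ξ| ≤ 1 := by
  rw [symbolDeriv, abs_mul]
  have h1 : |(if j = 0 then 1 else -1 : ℝ)| = 1 := by split_ifs <;> simp
  rw [h1, one_mul, abs_of_nonneg (by positivity)]
  exact div_le_one_of_le₀ (by nlinarith [sq_nonneg (ξ 0 ^ 2), sq_nonneg (ξ 1 ^ 2)]) (by positivity)

theorem measurable_symbolDeriv (j : Fin 2) : Measurable (symbolDeriv j) := by
  unfold symbolDeriv
  fun_prop

/-- The kernel is half the difference quotient of ξ_j m in direction e_j, with step -t and the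
factor ξ_j frozen, minus half of m. -/
theorem tendsto_nonlocalKernel {ξ : Plane} (hξ : ξ ≠ 0) (j : Fin 2) :
    Tendsto (fun t => nonlocalKernel t j ξ) (𝓝[≠] 0)
      (𝓝 (1 / 2 * (symbolDeriv j ξ - symbol ξ))) := by
  have h1 := ((hasDerivAt_symbol hξ j).tendsto_slope_zero.comp tendsto_neg_nhdsNE_zero)
  refine ((h1.sub_const (symbol ξ)).const_mul (1 / 2)).congr' ?_
  filter_upwards [self_mem_nhdsWithin] with t ht
  have ht' : t ≠ 0 := ht
  simp only [Function.comp_apply, nonlocalKernel, zero_add, zero_smul, add_zero, smul_eq_mul]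
  field_simp
  ring

theorem abs_nonlocalKernel_le (t : ℝ) (j : Fin 2) (ξ : Plane) : |nonlocalKernel t j ξ| ≤ 1 := by
  have h := abs_commutator_le (s := id) (C := 1) (by simp) rfl t j ξ
  rw [nonlocalKernel, abs_mul, abs_neg, abs_inv]
  refine (mul_le_mul_of_nonneg_left h (by positivity)).trans ?_
  rw [mul_one, ← abs_two (α := ℝ), ← abs_mul, abs_two]
  exact inv_mul_le_one

theorem measurable_nonlocalKernel (t : ℝ) (j : Fin 2) : Measurable (nonlocalKernel t j) := by
  have h1 : Measurable fun ξ : Plane => symbol (ξ + (-t) • basisVec j) :=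
    measurable_symbol.comp (measurable_add_const _)
  have h2 : Measurable fun ξ : Plane => ξ j := by fun_prop
  exact ((h2.mul h1).sub ((h2.sub_const t).mul measurable_symbol)).const_mul _

/-- The kernels are bounded by one and converge away from the origin, and the correlation tends to
|𝓕f|² in L¹ by continuity of translations in L². -/
theorem tendsto_integral_nonlocalKernel (f : L2) (j : Fin 2) :
    Tendsto (fun t => ∫ ξ, nonlocalKernel t j ξ * correlation f t j ξ) (𝓝[≠] 0)
      (𝓝 (∫ ξ, 1 / 2 * (symbolDeriv j ξ - symbol ξ) * ‖(𝓕 f : L2) ξ‖ ^ 2)) := by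
  have hf := Lp.memLp (𝓕 f : L2)
  have hsq : ∀ ξ, ((𝓕 f : L2) ξ * conj ((𝓕 f : L2) ξ)).re = ‖(𝓕 f : L2) ξ‖ ^ 2 := fun ξ => by
    rw [Complex.mul_conj, Complex.ofReal_re, Complex.normSq_eq_norm_sq]
  refine tendsto_integral_mul_of_L1 (fun t => (measurable_nonlocalKernel t j).aestronglyMeasurable)
    (fun t => abs_nonlocalKernel_le t j) ?_
    ((integrable_re_mul_conj hf hf).congr (Eventually.of_forall hsq))
    (fun t => integrable_correlation f t j) ?_
  · filter_upwards [compl_mem_ae_iff.2 (measure_singleton (0 : Plane))] with ξ hξ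
    exact tendsto_nonlocalKernel hξ j
  · have h1 := ENNReal.Tendsto.mul_const (b := eLpNorm (𝓕 f : L2) 2 volume)
      ((tendsto_eLpNorm_translate_sub (𝓕 f : L2) j).comp tendsto_neg_nhdsNE_zero)
      (Or.inr hf.2.ne)
    rw [zero_mul] at h1
    refine tendsto_of_tendsto_of_tendsto_of_le_of_le tendsto_const_nhds h1 (fun _ => zero_le)
      fun t => ?_
    refine (eLpNorm_le_mul_mul (p := 2) (q := 2) (C := 1)
      ((memLp_comp_add hf ((-t) • basisVec j)).1.sub hf.1) hf.1
      (Eventually.of_forall fun ξ => ?_)).trans_eq (by rw [ENNReal.ofReal_one, one_mul]; rfl)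
    rw [← hsq, correlation, ← Complex.sub_re, ← sub_mul, one_mul]
    refine (Complex.abs_re_le_norm _).trans_eq ?_
    rw [norm_mul, RCLike.norm_conj]
    rfl

theorem tendsto_integral_cos_mul {G : Plane → ℝ} (hG : Integrable G volume) (j : Fin 2) :
    Tendsto (fun t => ∫ x : Plane, cos (2 * π * t * x j) * G x) (𝓝[≠] 0) (𝓝 (∫ x, G x)) := by
  have h := tendsto_integral_mul_of_L1 (l := 𝓝[≠] (0 : ℝ))
    (q := fun t x => cos (2 * π * t * x j)) (q₀ := fun _ => 1) (F := fun _ => G) (f := G) (K := 1)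
    (fun t => by
      have : Continuous fun x : Plane => cos (2 * π * t * x j) := by fun_prop
      exact this.aestronglyMeasurable)
    (fun t x => abs_cos_le_one _)
    (Eventually.of_forall fun x => by
      have : Continuous fun t : ℝ => cos (2 * π * t * x j) := by fun_prop
      simpa using (this.tendsto 0).mono_left nhdsWithin_le_nhds)
    hG (fun _ => hG) (by simp)
  simpa using h

/-! ### The Pohozaev identity -/

/-- The identity with weight `cos (2π t x_j)`. -/
theorem IsSolution.weighted_identity {p ω : ℝ} (hp₁ : 1 < p) (hp₃ : p < 3) {u : L2}
    (h : IsSolution p ω u) {v : Fin 2 → L2} (hv : HasGradient u fun i => v i)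
    (hw : ∀ i, (𝓕 (v i) : L2) =ᵐ[volume]
      fun ξ => (2 * π * Complex.I * (ξ i : ℂ)) * (𝓕 u : L2) ξ) (j : Fin 2) {t : ℝ} (ht : t ≠ 0) :
    (1 / 2 * ∑ i, ∫ x : Plane, cos (2 * π * t * x j) * ‖v i x‖ ^ 2) -
      (∫ x : Plane, cos (2 * π * t * x j) * ‖v j x‖ ^ 2) +
      ω / 2 * (∫ x : Plane, cos (2 * π * t * x j) * ‖u x‖ ^ 2) -
      (p + 1)⁻¹ * (∫ x : Plane, cos (2 * π * t * x j) * ‖u x‖ ^ (p + 1)) +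
      1 / 2 * (∫ ξ, nonlocalKernel t j ξ *
        correlation ((memLp_ofReal_norm_sq hv.memLp_four).toLp _) t j ξ) = 0 := by
  have hφ := isWeight_sinWeight ht j
  obtain ⟨M₀, hM₀⟩ := hφ.bounded
  let M := max M₀ 1
  have hM : ∀ x, |sinWeight t j x| ≤ M := fun x => (hM₀ x).trans (le_max_left _ _)
  have hM' : ∀ i x, |fderiv ℝ (sinWeight t j) x (basisVec i)| ≤ M := fun i x => by
    rw [hφ.fderiv_eq]
    refine le_trans ?_ (le_max_right _ _)
    split_ifs
    · exact hφ.deriv_le x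
    · simp
  have hcc : Continuous fun x : Plane => cos (2 * π * t * x j) := by fun_prop
  -- When the gradient falls on the weight it produces cos(2πt x_j). Absorbing the cosine into v_j
  -- gives a fixed L² function against which central differences converge weakly.
  have hk := memLp_bounded_mul (b := fun x => (cos (2 * π * t * x j) : ℂ)) (by fun_prop) (C := 1)
    (fun x => by
      have := abs_cos_le_one (2 * π * t * x j)
      rw [← Real.norm_eq_abs, ← Complex.norm_real] at this
      simpa using this) (v j)
  let D : ℝ → Plane → ℂ := fun h x => u (x + h • basisVec j) - u (x + (-h) • basisVec j)
  let D' : Fin 2 → ℝ → Plane → ℂ := fun i h x =>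
    v i (x + h • basisVec j) - v i (x + (-h) • basisVec j)
  have hD : ∀ h, HasGradient (D h) fun i => D' i h := fun h =>
    (hv.comp_add (h • basisVec j)).sub (hv.comp_add ((-h) • basisVec j))
  -- The test function is the weight times the conjugate of the undivided central increment of u;
  -- the factor 1/(2h) is restored when the limits are taken.
  have hmul : ∀ h, HasGradient _ _ := fun h =>
    (hD h).conj.ofReal_mul hφ.contDiff hM hM'
  have L1 : ∀ i, Tendsto _ _ _ := fun i => hφ.tendsto_quadratic (v i)
  have L2' := tendsto_integral_centralDifference (k := hk.toLp _) (hw j)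
  have L3 := hφ.tendsto_quadratic u
  have L4 := hφ.tendsto_power hp₁ hp₃ hv (hw j)
  have L5 := tendsto_potential hv (hw j) ht
  have L := ((((tendsto_finsetSum Finset.univ fun i _ => L1 i).neg.sub L2').sub
    (L3.const_mul ω)).add L4).add L5
  -- The real part of the weak equation for this test function, with the gradient term split by the
  -- product rule; only the direction i = j sees the derivative of the weight.
  have e0 : ∀ h : ℝ,
      -(∑ i, ∫ x, sinWeight t j x * (v i x * conj (D' i h x)).re) -
      (∫ x, (hk.toLp _ x * conj (D h x)).re) -
      ω * (∫ x, sinWeight t j x * (u x * conj (D h x)).re) +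
      (∫ x, sinWeight t j x * (‖u x‖ ^ (p - 1) * (u x * conj (D h x)).re)) +
      (∫ x, sinWeight t j x * (potential u x * (u x * conj (D h x)).re)) = 0 := by
    intro h'
    have hE := congrArg Complex.re (h.weak_form hp₁ hp₃ hv (hmul h'))
    have hre : ∀ {g : Plane → ℂ} {k : Plane → ℝ}, Integrable g volume → (∀ x, (g x).re = k x) →
        (∫ x, g x).re = ∫ x, k x := fun {g k} hg hgk => by
      rw [← RCLike.re_eq_complex_re, ← integral_re hg]
      exact integral_congr_ae (Eventually.of_forall hgk)
    have hpot : ∀ {V β : Plane → ℝ}, AEStronglyMeasurable V volume → MemLp β 2 volume →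
        (∀ x, |V x| ≤ 1 + |β x|) →
        (∫ x, (V x : ℂ) * u x * ((sinWeight t j x : ℂ) * conj (D h' x))).re =
          ∫ x, sinWeight t j x * (V x * (u x * conj (D h' x)).re) := fun {V β} hV hβ hVβ => by
      refine hre (integrable_potential_mul hV hβ (Eventually.of_forall hVβ) hv.memLp
        (hmul h').memLp hv.memLp_four (hmul h').memLp_four) fun x => ?_
      rw [mul_assoc, Complex.re_ofReal_mul, mul_left_comm, Complex.re_ofReal_mul, mul_left_comm]
    have hu2 : MemLp (fun x => ‖u x‖ ^ 2) 2 volume :=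
      (memLp_ofReal_norm_sq hv.memLp_four).of_le (hv.memLp.1.norm.pow 2)
        (Eventually.of_forall fun x => by simp)
    have hpm : AEStronglyMeasurable (fun x => ‖u x‖ ^ (p - 1)) volume :=
      (Real.continuous_rpow_const (by linarith)).comp_aestronglyMeasurable hv.memLp.1.norm
    have hV := memLp_potential hv.memLp_four
    have t3 := hpot hpm hu2 fun x => by
      rw [abs_of_nonneg (by positivity), abs_of_nonneg (by positivity)]
      exact rpow_le_one_add_sq hp₁ hp₃ (norm_nonneg _)
    have t4 := hpot hV.1 hV fun x => by linarith
    have t2 : (∫ x, u x * ((sinWeight t j x : ℂ) * conj (D h' x))).re =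
        ∫ x, sinWeight t j x * (u x * conj (D h' x)).re :=
      hre (hv.memLp.integrable_mul (hmul h').memLp) fun x => by
        rw [mul_left_comm, Complex.re_ofReal_mul]
    have t1 : ∀ i, (∫ x, v i x * ((sinWeight t j x : ℂ) * conj (D' i h' x) +
        (fderiv ℝ (sinWeight t j) x (basisVec i) : ℂ) * conj (D h' x))).re =
        (∫ x, sinWeight t j x * (v i x * conj (D' i h' x)).re) +
          if i = j then ∫ x, (hk.toLp _ x * conj (D h' x)).re else 0 := by
      intro i
      rw [hre (g := fun x => v i x * ((sinWeight t j x : ℂ) * conj (D' i h' x) +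
        (fderiv ℝ (sinWeight t j) x (basisVec i) : ℂ) * conj (D h' x)))
        (k := fun x => sinWeight t j x * (v i x * conj (D' i h' x)).re +
          (if i = j then cos (2 * π * t * x j) else 0) * (v i x * conj (D h' x)).re)
        ((hv.memLp' i).integrable_mul ((hmul h').memLp' i)) fun x => by
          rw [hφ.fderiv_eq, mul_add, Complex.add_re, mul_left_comm, Complex.re_ofReal_mul,
            mul_left_comm, Complex.re_ofReal_mul]]
      have i1 : Integrable (fun x => sinWeight t j x * (v i x * conj (D' i h' x)).re) volume :=
        (integrable_re_mul_conj (hv.memLp' i) ((hD h').memLp' i)).bdd_mul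
          hφ.contDiff.continuous.aestronglyMeasurable (Eventually.of_forall hM)
      rcases eq_or_ne i j with rfl | hij
      · simp only [if_true]
        rw [integral_add i1 ((integrable_re_mul_conj (hv.memLp' i) (hD h').memLp).bdd_mul
          hcc.aestronglyMeasurable (Eventually.of_forall fun x => abs_cos_le_one _))]
        congr 1
        refine integral_congr_ae ?_
        filter_upwards [hk.coeFn_toLp] with x hx
        rw [hx, ← Complex.re_ofReal_mul, mul_assoc (Complex.ofReal _)]
      · simp [hij]
    simp only [Complex.add_re, Complex.sub_re, Complex.neg_re, Complex.re_sum, Complex.zero_re,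
      Complex.re_ofReal_mul] at hE
    rw [t2, t3, t4, Finset.sum_congr rfl fun i _ => t1 i, Finset.sum_add_distrib,
      Finset.sum_ite_eq' Finset.univ j, if_pos (Finset.mem_univ j), neg_add] at hE
    exact hE
  have hz : Tendsto (fun _ : ℝ => (0 : ℝ)) (𝓝[≠] 0) _ := L.congr fun h' => by
    have := e0 h'
    simp only [D, D'] at this
    rw [← Finset.mul_sum]
    linear_combination (2 * h')⁻¹ * this
  have hlim := tendsto_nhds_unique hz tendsto_const_nhds
  have ek : ∫ x, (hk.toLp _ x * conj (v j x)).re =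
      ∫ x : Plane, cos (2 * π * t * x j) * ‖v j x‖ ^ 2 := by
    refine integral_congr_ae ?_
    filter_upwards [hk.coeFn_toLp] with x hx
    rw [hx, mul_assoc, Complex.mul_conj, Complex.re_ofReal_mul, Complex.ofReal_re,
      Complex.normSq_eq_norm_sq]
  rw [ek, ← Finset.mul_sum] at hlim
  linear_combination hlim

/-- Letting t → 0 in the weighted identity gives the relation that x_j ∂_j ū would give, for each j
separately. In the sum over the two coordinates the gradient terms cancel, since each direction
carries ½ twice and -1 once. -/
theorem IsSolution.pohozaev {p ω : ℝ} (hp₁ : 1 < p) (hp₃ : p < 3) {u : L2}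
    (h : IsSolution p ω u) (hu4 : MemLp u 4 volume) :
    ω * ∫ x, ‖u x‖ ^ 2 = 2 * (p + 1)⁻¹ * (∫ x, ‖u x‖ ^ (p + 1)) +
      1 / 2 * ∫ ξ, symbol ξ * ‖(𝓕 ((memLp_ofReal_norm_sq hu4).toLp _) : L2) ξ‖ ^ 2 := by
  obtain ⟨v, hv, hw⟩ := exists_hasGradient h.memH1
  set ρ : L2 := (memLp_ofReal_norm_sq hu4).toLp _ with hρ
  have hsq : ∀ f : L2, Integrable (fun x => ‖f x‖ ^ 2) volume := fun f =>
    (Lp.memLp f).integrable_norm_pow (by simp)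
  have key : ∀ j, (1 / 2 * ∑ i, ∫ x, ‖v i x‖ ^ 2) - (∫ x, ‖v j x‖ ^ 2) +
      ω / 2 * (∫ x, ‖u x‖ ^ 2) - (p + 1)⁻¹ * (∫ x, ‖u x‖ ^ (p + 1)) +
      1 / 2 * (∫ ξ, 1 / 2 * (symbolDeriv j ξ - symbol ξ) * ‖(𝓕 ρ : L2) ξ‖ ^ 2) = 0 := by
    intro j
    have L := ((((tendsto_finsetSum Finset.univ fun i _ =>
      tendsto_integral_cos_mul (hsq (v i)) j).const_mul (1 / 2)).sub
      (tendsto_integral_cos_mul (hsq (v j)) j)).add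
      ((tendsto_integral_cos_mul (hsq u) j).const_mul (ω / 2))).sub
      ((tendsto_integral_cos_mul (integrable_norm_rpow hp₁ hp₃ hv) j).const_mul (p + 1)⁻¹) |>.add
      ((tendsto_integral_nonlocalKernel ρ j).const_mul (1 / 2))
    refine tendsto_nhds_unique (L.congr' ?_) tendsto_const_nhds
    filter_upwards [self_mem_nhdsWithin] with t ht
    exact h.weighted_identity hp₁ hp₃ hv hw j ht
  have hi : ∀ j, Integrable (fun ξ => 1 / 2 * (symbolDeriv j ξ - symbol ξ) *
      ‖(𝓕 ρ : L2) ξ‖ ^ 2) volume := fun j => by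
    refine (hsq (𝓕 ρ)).bdd_mul (c := 1) (((measurable_symbolDeriv j).sub
      measurable_symbol).const_mul (1 / 2)).aestronglyMeasurable (Eventually.of_forall fun ξ => ?_)
    have h1 := abs_le.1 (abs_symbolDeriv_le j ξ)
    have h2 := symbol_nonneg ξ
    have h3 := symbol_le_one ξ
    rw [Real.norm_eq_abs, abs_le]
    constructor <;> linarith
  -- Euler's relation for a symbol of degree zero: the terms ξ_j ∂_j m cancel in the sum over j.
  have hs : (∫ ξ, 1 / 2 * (symbolDeriv 0 ξ - symbol ξ) * ‖(𝓕 ρ : L2) ξ‖ ^ 2) +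
      (∫ ξ, 1 / 2 * (symbolDeriv 1 ξ - symbol ξ) * ‖(𝓕 ρ : L2) ξ‖ ^ 2) =
      -∫ ξ, symbol ξ * ‖(𝓕 ρ : L2) ξ‖ ^ 2 := by
    rw [← integral_add (hi 0) (hi 1), ← integral_neg]
    refine integral_congr_ae (Eventually.of_forall fun ξ => ?_)
    simp only [symbolDeriv, if_true, if_neg (by decide : ¬ (1 : Fin 2) = 0)]
    ring
  have k0 := key 0
  have k1 := key 1
  rw [Fin.sum_univ_two] at k0 k1
  linear_combination k0 + k1 - 1 / 2 * hs

end DaveyStewartson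

end

/-! ### Positivity of the frequency -/

theorem theorem2p3 (p ω : ℝ) (hp₁ : 1 < p) (hp₃ : p < 3)
    (h : ∃ u : DaveyStewartson.L2, u ≠ 0 ∧ DaveyStewartson.IsSolution p ω u) :
    0 < ω := by
  obtain ⟨u, hu, h⟩ := h
  obtain ⟨v, hv, -⟩ := DaveyStewartson.exists_hasGradient h.memH1
  have hP := h.pohozaev hp₁ hp₃ hv.memLp_four
  have h1 : 0 < ∫ x, ‖u x‖ ^ (p + 1) := by
    refine lt_of_le_of_ne (integral_nonneg fun x => by positivity) fun h0 => hu ?_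
    have h2 := (integral_eq_zero_iff_of_nonneg (fun x => by positivity)
      (DaveyStewartson.integrable_norm_rpow hp₁ hp₃ hv)).1 h0.symm
    refine Lp.eq_zero_iff_ae_eq_zero.2 ?_
    filter_upwards [h2] with x hx
    exact norm_eq_zero.1 ((Real.rpow_eq_zero (norm_nonneg _) (by linarith)).1 hx)
  have h2 : 0 ≤ ∫ ξ, DaveyStewartson.symbol ξ * ‖(𝓕 ((DaveyStewartson.memLp_ofReal_norm_sq
      hv.memLp_four).toLp _) : DaveyStewartson.L2) ξ‖ ^ 2 :=
    integral_nonneg fun ξ => mul_nonneg (DaveyStewartson.symbol_nonneg ξ) (by positivity)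
  have h3 : 0 < 2 * (p + 1)⁻¹ * ∫ x, ‖u x‖ ^ (p + 1) := by
    have : 0 < p + 1 := by linarith
    positivity
  exact pos_of_mul_pos_left (b := ∫ x, ‖u x‖ ^ 2) (by rw [hP]; linarith)
    (integral_nonneg fun x => by positivity)
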